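/- Let $(Y,X,Z)$ have law $Q_0$, where $Y$ is real, $X\in\mathbb R^d$, and $Z$ takes values in an arbitrary measurable space; let $R\in\{0,1\}$ be independent of $(Y,X,Z)$ with $\Pr(R=1)=\pi$, where $0<\pi<1$ is fixed and known. One observes $(R,X,Z,RY)$, with law $P_0$. Let $\psi(y,x;\theta)\in\mathbb R^q$ be measurable in $(y,x)$ for each $\theta\in\Theta$, where $\Theta\subset\mathbb R^q$ is compact, and let $\theta_0$, an interior point of $\Theta$, be the unique solution in $\Theta$ of $E\,\psi(Y,X;\theta)=0$. Assume: $\sup_{\theta\in\Theta}E\|\psi(Y,X;\theta)\|^2<\infty$; $\theta\mapsto E\,\psi(Y,X;\theta)$ is continuous on $\Theta$ and strictly differentiable at $\theta_0$ (e.g. continuously differentiable near $\theta_0$), with nonsingular matrix $$A=-\frac{\partial}{\partial\theta^{\rm T}}E\,\psi(Y,X;\theta)\Big|_{\theta=\theta_0};$$ $E\|\psi(Y,X;\theta)-\psi(Y,X;\theta_0)\|^2\to0$ as $\theta\to\theta_0$; and, for some $L$, $E\|\psi(Y,X;\theta')-\psi(Y,X;\theta'')\|\le L\|\theta'-\theta''\|$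 for all $\theta',\theta''$ near $\theta_0$. Consider the semiparametric model of all laws $Q$ of $(Y,X,Z)$ for which $\psi(Y,X;\theta)$, $\theta\in\Theta$, is square integrable and $E_Q\psi(Y,X;\theta)=0$ has exactly one solution $\theta(Q)$ in $\Theta$. A regular parametric submodel is a family $Q_\eta$, with $\eta\in\mathbb R^k$ near $0$, of laws in this model with $Q_{\eta=0}=Q_0$, such that the induced laws of $(R,X,Z,RY)$ are dominated by a $\sigma$-finite measure and differentiable in quadratic mean at $\eta=0$ with score $S\in L^2(P_0)^k$, the moments $E_{Q_\eta}\|\psi(Y,X;\theta)\|^2$ are bounded uniformly in $\theta\in\Theta$ and $\eta$ near $0$, and $E_{Q_\eta}\|\psi(Y,X;\theta)-\psi(Y,X;\theta_0)\|^2\to0$ as $(\eta,\theta)\to(0,\theta_0)$. The tangent space $\mathcal T$ is the closure in $L^2(P_0)$ of the linear span of all $v^{\rm T}S$, over all scores $S$ of regular parametric submodels (of all dimensions $k$) and all $v\in\mathbb R^k$. An efficient influence function for $\theta$ is a square integrable function $\phi$ of the observed datum with values in $\mathbb R^q$, with all coordinates in $\mathcal T$, such that along every regular parametric submodel $\theta(Q_\eta)$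 is differentiable at $\eta=0$ with $\partial\theta/\partial\eta^{\rm T}=E\{\phi S^{\rm T}\}$. Then $$\phi=\frac r\pi A^{-1}\bigl[\psi(y,x;\theta_0)-E\{\psi(Y,x;\theta_0)\mid x,z\}\bigr]+A^{-1}E\{\psi(Y,x;\theta_0)\mid x,z\}$$ is an efficient influence function for $\theta$ at $Q_0$, and it is the only one up to $P_0$-almost sure equality. -/

import Mathlib

open MeasureTheory ProbabilityTheory Filter Topology Asymptotics
open scoped ENNReal NNReal InnerProductSpace

namespace MissingLabel

noncomputable section

/-- Real vectors with the Euclidean norm. -/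
abbrev Vec (n : ℕ) : Type := EuclideanSpace ℝ (Fin n)

/-- A full datum `((x, z), y)`: covariates `x ∈ ℝᵈ`, auxiliary variable `z`, scalar outcome `y`. -/
abbrev FullDatum (d : ℕ) (Z : Type*) : Type _ := (Vec d × Z) × ℝ

/-- An observed datum `(r, (x, z), r y)`: label indicator `r`, covariates and auxiliary variable,
and the outcome, the slot of which is filled with `0` when the label is missing. -/
abbrev ObsDatum (d : ℕ) (Z : Type*) : Type _ := Bool × (Vec d × Z) × ℝ

/-- The Bernoulli law of the label indicator, with labeling probability `π`. -/
def labelLaw (π : ℝ) : Measure Bool :=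
  ENNReal.ofReal π • Measure.dirac true + ENNReal.ofReal (1 - π) • Measure.dirac false

/-- Coarsening: the outcome is seen only if the label indicator is `true`. -/
def observe {d : ℕ} {Z : Type*} (u : Bool × FullDatum d Z) : ObsDatum d Z :=
  (u.1, u.2.1, if u.1 then u.2.2 else 0)

/-- The law of an observed datum, when `((X, Z), Y)` has law `Q` and the label indicator is
Bernoulli with parameter `π` and independent of `((X, Z), Y)`. -/
def obsLaw {d : ℕ} {Z : Type*} [MeasurableSpace Z] (π : ℝ) (Q : Measure (FullDatum d Z)) :
    Measure (ObsDatum d Z) :=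
  ((labelLaw π).prod Q).map observe

/-- The estimating function `ψ(y, x; θ)` at `θ`, as a function of the full datum. -/
def estFun {d q : ℕ} {Z : Type*} (ψ : ℝ → Vec d → Vec q → Vec q) (θ : Vec q)
    (u : FullDatum d Z) : Vec q :=
  ψ u.2 u.1.1 θ

/-- The (otherwise unrestricted) semiparametric model: all laws `Q` of `((X, Z), Y)` under which
`ψ(Y, X; θ)` is square integrable for `θ ∈ Θ` and `E_Q ψ(Y, X; θ) = 0` has exactly one solution
in `Θ`. -/
def InModel {d q : ℕ} {Z : Type*} [MeasurableSpace Z] (ψ : ℝ → Vec d → Vec q → Vec q)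
    (Θ : Set (Vec q)) (Q : Measure (FullDatum d Z)) : Prop :=
  IsProbabilityMeasure Q ∧ (∀ θ ∈ Θ, MemLp (estFun ψ θ) 2 Q) ∧
    ∃! θ : Vec q, θ ∈ Θ ∧ ∫ u, estFun ψ θ u ∂Q = 0

/-- The parameter `θ(Q)`: the solution in `Θ` of `E_Q ψ(Y, X; θ) = 0` (for `Q` in the model). -/
def param {d q : ℕ} {Z : Type*} [MeasurableSpace Z] (ψ : ℝ → Vec d → Vec q → Vec q)
    (Θ : Set (Vec q)) (Q : Measure (FullDatum d Z)) : Vec q :=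
  Classical.epsilon fun θ : Vec q => θ ∈ Θ ∧ ∫ u, estFun ψ θ u ∂Q = 0

/-- Differentiability in quadratic mean at `η = 0`, with score vector `s`, of a parametric family
`P η`, `η ∈ ℝᵏ`, of laws dominated (near `0`) by a σ-finite measure `μ`:
`∫ (√p_η - √p_0 - ½ ⟨s, η⟩ √p_0)² dμ = o(‖η‖²)`. -/
def HasScore {Ω : Type*} [MeasurableSpace Ω] {k : ℕ} (P : Vec k → Measure Ω) (s : Ω → Vec k) :
    Prop :=
  MemLp s 2 (P 0) ∧ ∃ μ : Measure Ω, SigmaFinite μ ∧ (∀ᶠ η in 𝓝 0, P η ≪ μ) ∧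
    (fun η : Vec k => ∫ o, (√((P η).rnDeriv μ o).toReal - √((P 0).rnDeriv μ o).toReal
        - (1 / 2) * ⟪s o, η⟫_ℝ * √((P 0).rnDeriv μ o).toReal) ^ 2 ∂μ)
      =o[𝓝 0] fun η => ‖η‖ ^ 2

/-- `Q η`, `η ∈ ℝᵏ` near `0`, is a regular parametric submodel through `Q₀` (where `θ₀ = θ(Q₀)`),
and `s` is its score vector for the observed data:
it starts at `Q₀` and stays in the model, the induced observed-data laws are differentiable in
quadratic mean with score `s`, second moments of `ψ(Y, X; θ)` are bounded along it uniformly in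
`θ ∈ Θ`, and `ψ(Y, X; θ)` is mean square continuous in `θ` at `θ₀` locally uniformly along it. -/
structure IsRegularSubmodel {d q : ℕ} {Z : Type*} [MeasurableSpace Z]
    (ψ : ℝ → Vec d → Vec q → Vec q) (Θ : Set (Vec q)) (π : ℝ)
    (Q₀ : Measure (FullDatum d Z)) (θ₀ : Vec q)
    {k : ℕ} (Q : Vec k → Measure (FullDatum d Z)) (s : ObsDatum d Z → Vec k) : Prop where
  at_zero : Q 0 = Q₀
  mem : ∀ᶠ η in 𝓝 0, InModel ψ Θ (Q η)
  score : HasScore (fun η => obsLaw π (Q η)) s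
  moment : ∃ C : ℝ≥0, ∀ᶠ η in 𝓝 0, ∀ θ ∈ Θ, ∫⁻ u, ‖estFun ψ θ u‖ₑ ^ 2 ∂(Q η) ≤ C
  cont : Tendsto (fun p : Vec k × Vec q =>
      ∫⁻ u, ‖estFun ψ p.2 u - estFun ψ θ₀ u‖ₑ ^ 2 ∂(Q p.1)) (𝓝 (0, θ₀)) (𝓝 0)

/-- The tangent space of the observed-data model at `Q₀`: the mean square closure of the linear
span of all coordinates (in all directions `v`) of the score vectors of all regular parametric
submodels. -/
def tangentSpace {d q : ℕ} {Z : Type*} [MeasurableSpace Z]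
    (ψ : ℝ → Vec d → Vec q → Vec q) (Θ : Set (Vec q)) (π : ℝ)
    (Q₀ : Measure (FullDatum d Z)) (θ₀ : Vec q) : Submodule ℝ (Lp ℝ 2 (obsLaw π Q₀)) :=
  (Submodule.span ℝ {g : Lp ℝ 2 (obsLaw π Q₀) |
    ∃ (k : ℕ) (Q : Vec k → Measure (FullDatum d Z)) (s : ObsDatum d Z → Vec k) (v : Vec k),
      IsRegularSubmodel ψ Θ π Q₀ θ₀ Q s ∧
        g =ᵐ[obsLaw π Q₀] fun o => ⟪s o, v⟫_ℝ}).topologicalClosure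

/-- `φ` is an efficient influence function (canonical gradient) at `Q₀` for the parameter `θ(·)`:
its coordinates belong to the tangent space, and along every regular parametric submodel
`θ(Q η)` is differentiable at `η = 0` with derivative `∂θ/∂ηᵀ = E {φ sᵀ}`. -/
structure IsEIF {d q : ℕ} {Z : Type*} [MeasurableSpace Z]
    (ψ : ℝ → Vec d → Vec q → Vec q) (Θ : Set (Vec q)) (π : ℝ)
    (Q₀ : Measure (FullDatum d Z)) (θ₀ : Vec q) (φ : ObsDatum d Z → Vec q) : Prop where
  memLp : MemLp φ 2 (obsLaw π Q₀)
  mem_tangent : ∀ j : Fin q, ∃ g ∈ tangentSpace ψ Θ π Q₀ θ₀,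
    g =ᵐ[obsLaw π Q₀] fun o => φ o j
  gradient : ∀ (k : ℕ) (Q : Vec k → Measure (FullDatum d Z)) (s : ObsDatum d Z → Vec k),
    IsRegularSubmodel ψ Θ π Q₀ θ₀ Q s →
      ∃ D : Vec k →L[ℝ] Vec q,
        (∀ v : Vec k, D v = ∫ o, ⟪s o, v⟫_ℝ • φ o ∂(obsLaw π Q₀)) ∧
        HasFDerivAt (fun η => param ψ Θ (Q η)) D 0

/-- `E {ψ(Y, x; θ) | x, z}`, the mean of `ψ(·, x; θ)` under the regular conditional law of `Y`
given `(X, Z) = (x, z)`. -/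
def condMean {d q : ℕ} {Z : Type*} [MeasurableSpace Z] (ψ : ℝ → Vec d → Vec q → Vec q)
    (θ : Vec q) (Q : Measure (FullDatum d Z)) [IsFiniteMeasure Q] (w : Vec d × Z) : Vec q :=
  ∫ y, ψ y w.1 θ ∂(Q.condKernel w)

/-- `(r / π) A⁻¹ [ψ(y, x; θ) - E {ψ(Y, x; θ) | x, z}] + A⁻¹ E {ψ(Y, x; θ) | x, z}`. -/
def eifFormula {d q : ℕ} {Z : Type*} [MeasurableSpace Z] (ψ : ℝ → Vec d → Vec q → Vec q)
    (π : ℝ) (A : Matrix (Fin q) (Fin q) ℝ) (θ : Vec q)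
    (Q : Measure (FullDatum d Z)) [IsFiniteMeasure Q] : ObsDatum d Z → Vec q :=
  fun (r, (x, z), y) =>
    ((if r then 1 else 0) / π) •
        Matrix.toEuclideanCLM (𝕜 := ℝ) A⁻¹ (ψ y x θ - condMean ψ θ Q (x, z))
      + Matrix.toEuclideanCLM (𝕜 := ℝ) A⁻¹ (condMean ψ θ Q (x, z))

end

end MissingLabel

open MissingLabel

/-! ### The observed law as a mixture over the label -/

namespace MissingLabel

variable {d q : ℕ} {Z : Type*} [MeasurableSpace Z]

/-! Write `m_Q(θ) = E_Q ψ(Y, X; θ)`. Since the label is independent of the full datum, `m_Q(θ)` is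
the observed-data mean of `(r/π) ψ`. Along a family with score `S`, the mean of a function `f` with
bounded second moments has derivative `E{f S}`, uniformly over such functions
(`HasScore.expansion_vec`). The uniformity allows evaluation at the moving root `θ(Q_η)`: it gives
consistency (`tendsto_param`) and then, by linearizing `m` at `θ₀` (`hasFDerivAt_of_root`), the
derivative `A⁻¹ E{(r/π) ψ Sᵀ}` (`hasFDerivAt_param`). An augmentation term `(1 - r/π) g(x, z)` has
mean zero under every law because `π` is known, so it is uncorrelated with every score
(`HasScore.integral_smul_augment`). Adding `A⁻¹ (1 - r/π) E(ψ | x, z)` therefore changes no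
derivative, and the sum is the claimed `φ`.

For membership in the tangent space, take a bounded full-data function `h` of mean zero and tilt
`Q₀` by `1 + t h`. The mean of `ψ` becomes `m + t p` with `p` bounded on `Θ` and Lipschitz near
`θ₀`, so the root persists and stays unique (`eventually_existsUnique_root`), and the tilts form a
regular submodel. The observed law is tilted by `r h + (1 - r) E(h | x, z)` (`obsLaw_tilt`).
Truncation extends this to square integrable `h` of mean zero (`toLp_obsScore_mem`). With `f` a
coordinate of `A⁻¹ ψ`, the choice `h = π⁻¹ f + (1 - π⁻¹) E(f | x, z)` yields that coordinate of `φ`.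

For uniqueness, two efficient influence functions have the same inner products with all scores;
their difference lies in the tangent space and is orthogonal to it. -/

theorem isProbabilityMeasure_labelLaw {π : ℝ} (h₀ : 0 < π) (h₁ : π < 1) :
    IsProbabilityMeasure (labelLaw π) := by
  constructor
  rw [labelLaw]
  simp only [Measure.coe_add, Measure.coe_smul, Pi.add_apply, Pi.smul_apply, measure_univ,
    smul_eq_mul, mul_one]
  rw [← ENNReal.ofReal_add h₀.le (by linarith)]
  simp

/-- The observed datum when the outcome is labeled. -/
def seen (u : FullDatum d Z) : ObsDatum d Z := (true, u.1, u.2)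

/-- The observed datum when the outcome is missing. -/
def unseen (u : FullDatum d Z) : ObsDatum d Z := (false, u.1, 0)

theorem measurable_seen : Measurable (seen : FullDatum d Z → ObsDatum d Z) := by
  unfold seen; fun_prop

theorem measurable_unseen : Measurable (unseen : FullDatum d Z → ObsDatum d Z) := by
  unfold unseen; fun_prop

theorem measurable_observe : Measurable (observe : Bool × FullDatum d Z → ObsDatum d Z) := by
  unfold observe
  refine measurable_fst.prodMk (Measurable.prodMk (by fun_prop) ?_)
  exact Measurable.ite (measurable_fst (measurableSet_singleton true)) (by fun_prop) (by fun_prop)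

/-- Conditioning on the independent label separates labeled from unlabeled data; integrals, moments
and null sets of the observed law are computed through this splitting. -/
theorem obsLaw_eq (π : ℝ) (Q : Measure (FullDatum d Z)) [SFinite Q] :
    obsLaw π Q = ENNReal.ofReal π • Q.map seen + ENNReal.ofReal (1 - π) • Q.map unseen := by
  rw [obsLaw, labelLaw, Measure.add_prod, Measure.prod_smul_left, Measure.prod_smul_left,
    Measure.map_add _ _ measurable_observe, Measure.map_smul, Measure.map_smul,
    Measure.dirac_prod, Measure.dirac_prod, Measure.map_map measurable_observe (by fun_prop),
    Measure.map_map measurable_observe (by fun_prop)]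
  rfl

theorem isProbabilityMeasure_obsLaw {π : ℝ} (h₀ : 0 < π) (h₁ : π < 1)
    (Q : Measure (FullDatum d Z)) [IsProbabilityMeasure Q] :
    IsProbabilityMeasure (obsLaw π Q) := by
  have := isProbabilityMeasure_labelLaw h₀ h₁
  exact Measure.isProbabilityMeasure_map measurable_observe.aemeasurable

theorem lintegral_obsLaw (π : ℝ) (Q : Measure (FullDatum d Z)) [SFinite Q]
    {f : ObsDatum d Z → ℝ≥0∞} (hf : Measurable f) :
    ∫⁻ o, f o ∂(obsLaw π Q) = ENNReal.ofReal π * ∫⁻ u, f (seen u) ∂Q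
      + ENNReal.ofReal (1 - π) * ∫⁻ u, f (unseen u) ∂Q := by
  rw [obsLaw_eq, lintegral_add_measure, lintegral_smul_measure, lintegral_smul_measure,
    lintegral_map hf measurable_seen, lintegral_map hf measurable_unseen]
  rfl

theorem aestronglyMeasurable_seen {E : Type*} [TopologicalSpace E] {π : ℝ} (h₀ : 0 < π)
    {Q : Measure (FullDatum d Z)} [SFinite Q] {f : ObsDatum d Z → E}
    (hf : AEStronglyMeasurable f (obsLaw π Q)) :
    AEStronglyMeasurable f (Q.map seen) := by
  refine hf.mono_ac ?_
  rw [obsLaw_eq]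
  refine Measure.AbsolutelyContinuous.add_right ?_ _
  exact Measure.absolutelyContinuous_smul (by simpa using h₀)

theorem aestronglyMeasurable_unseen {E : Type*} [TopologicalSpace E] {π : ℝ} (h₁ : π < 1)
    {Q : Measure (FullDatum d Z)} [SFinite Q] {f : ObsDatum d Z → E}
    (hf : AEStronglyMeasurable f (obsLaw π Q)) :
    AEStronglyMeasurable f (Q.map unseen) := by
  refine hf.mono_ac ?_
  rw [obsLaw_eq, add_comm]
  refine Measure.AbsolutelyContinuous.add_right ?_ _
  exact Measure.absolutelyContinuous_smul (by simpa using h₁)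

theorem integrable_obsLaw_iff {E : Type*} [NormedAddCommGroup E] {π : ℝ} (h₀ : 0 < π)
    (h₁ : π < 1) {Q : Measure (FullDatum d Z)} [SFinite Q] {f : ObsDatum d Z → E}
    (hf : AEStronglyMeasurable f (obsLaw π Q)) :
    Integrable f (obsLaw π Q) ↔
      Integrable (fun u => f (seen u)) Q ∧ Integrable (fun u => f (unseen u)) Q := by
  have h1 := aestronglyMeasurable_seen h₀ hf
  have h2 := aestronglyMeasurable_unseen h₁ hf
  rw [obsLaw_eq, integrable_add_measure,
    integrable_smul_measure (by simpa using h₀) ENNReal.ofReal_ne_top,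
    integrable_smul_measure (by simpa using h₁) ENNReal.ofReal_ne_top,
    integrable_map_measure h1 measurable_seen.aemeasurable,
    integrable_map_measure h2 measurable_unseen.aemeasurable]
  rfl

theorem integral_obsLaw {E : Type*} [NormedAddCommGroup E] [NormedSpace ℝ E] {π : ℝ}
    (h₀ : 0 < π) (h₁ : π < 1) {Q : Measure (FullDatum d Z)} [SFinite Q] {f : ObsDatum d Z → E}
    (hf : Integrable f (obsLaw π Q)) :
    ∫ o, f o ∂(obsLaw π Q) = π • ∫ u, f (seen u) ∂Q + (1 - π) • ∫ u, f (unseen u) ∂Q := by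
  have h1 := aestronglyMeasurable_seen h₀ hf.1
  have h2 := aestronglyMeasurable_unseen h₁ hf.1
  rw [obsLaw_eq] at hf ⊢
  rw [integral_add_measure hf.left_of_add_measure hf.right_of_add_measure,
    integral_smul_measure, integral_smul_measure,
    integral_map measurable_seen.aemeasurable h1, integral_map measurable_unseen.aemeasurable h2,
    ENNReal.toReal_ofReal h₀.le, ENNReal.toReal_ofReal (by linarith)]

end MissingLabel

/-! ### First-order expansion of means under differentiability in quadratic mean -/

namespace MissingLabel

theorem integral_abs_mul_le_sqrt_mul_sqrt {Ω : Type*} [MeasurableSpace Ω] {μ : Measure Ω}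
    {f g : Ω → ℝ} (hf : MemLp f 2 μ) (hg : MemLp g 2 μ) :
    ∫ o, |f o| * |g o| ∂μ ≤ √(∫ o, f o ^ 2 ∂μ) * √(∫ o, g o ^ 2 ∂μ) := by
  have := integral_mul_norm_le_Lp_mul_Lq (f := f) (g := g) Real.HolderConjugate.two_two
    (by simpa using hf) (by simpa using hg)
  simpa [Real.sqrt_eq_rpow] using this

theorem integrable_abs_mul_of_memLp {Ω : Type*} [MeasurableSpace Ω] {μ : Measure Ω}
    {f g : Ω → ℝ} (hf : MemLp f 2 μ) (hg : MemLp g 2 μ) :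
    Integrable (fun o => |f o| * |g o|) μ := by
  have := (hf.integrable_mul hg).abs
  simpa [abs_mul] using this

/-- The remainder in the expansion of `∫ f a²` around `b`, where `r = a - b - w b / 2`. -/
theorem abs_integral_expansion_le {Ω : Type*} [MeasurableSpace Ω] {μ : Measure Ω}
    {f a b w τ : Ω → ℝ} {M n : ℝ} (hM : 0 ≤ M) (hn : 0 ≤ n)
    (ha : MemLp a 2 μ) (hb : MemLp b 2 μ) (hwb : MemLp (fun o => w o * b o) 2 μ)
    (hfa : MemLp (fun o => f o * a o) 2 μ) (hfb : MemLp (fun o => f o * b o) 2 μ)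
    (hτ : MemLp τ 2 μ) (hb₀ : ∀ o, 0 ≤ b o)
    (hw : ∀ o, |w o| ≤ n * M ∨ |w o| * b o ≤ n * |τ o|) :
    |∫ o, f o * a o ^ 2 ∂μ - ∫ o, f o * b o ^ 2 ∂μ - ∫ o, f o * w o * b o ^ 2 ∂μ| ≤
      √(∫ o, (a o - b o - (1 / 2) * w o * b o) ^ 2 ∂μ) *
          (√(∫ o, (f o * a o) ^ 2 ∂μ) + √(∫ o, (f o * b o) ^ 2 ∂μ))
        + n * (M * (√(∫ o, (f o * b o) ^ 2 ∂μ) * √(∫ o, (a o - b o) ^ 2 ∂μ))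
          + √(∫ o, τ o ^ 2 ∂μ) * (√(∫ o, (f o * a o) ^ 2 ∂μ) + √(∫ o, (f o * b o) ^ 2 ∂μ))) := by
  have hr : MemLp (fun o => a o - b o - (1 / 2) * w o * b o) 2 μ := by
    convert (ha.sub hb).sub (hwb.const_mul (1 / 2)) using 2 with o
    simp [mul_assoc]
  have hab : MemLp (fun o => a o - b o) 2 μ := ha.sub hb
  have i1 : Integrable (fun o => f o * a o ^ 2) μ := by
    convert hfa.integrable_mul ha using 2 with o
    simp; ring
  have i2 : Integrable (fun o => f o * b o ^ 2) μ := by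
    convert hfb.integrable_mul hb using 2 with o
    simp; ring
  have i3 : Integrable (fun o => f o * w o * b o ^ 2) μ := by
    convert hfb.integrable_mul hwb using 2 with o
    simp; ring
  have j1 := integrable_abs_mul_of_memLp hr hfa
  have j2 := integrable_abs_mul_of_memLp hr hfb
  have j3 := integrable_abs_mul_of_memLp hfb hab
  have j4 := integrable_abs_mul_of_memLp hτ hfa
  have j5 := integrable_abs_mul_of_memLp hτ hfb
  rw [← integral_sub i1 i2, ← integral_sub (by exact i1.sub i2) i3]
  refine (abs_integral_le_integral_abs).trans ?_
  have key : ∀ o, |f o * a o ^ 2 - f o * b o ^ 2 - f o * w o * b o ^ 2| ≤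
      (|a o - b o - (1 / 2) * w o * b o| * |f o * a o|
        + |a o - b o - (1 / 2) * w o * b o| * |f o * b o|)
      + n * (M * (|f o * b o| * |a o - b o|) + (|τ o| * |f o * a o| + |τ o| * |f o * b o|)) := by
    intro o
    -- Factor `a² - b² = (a - b)(a + b)` and substitute `a - b = r + w b / 2`.
    have e : f o * a o ^ 2 - f o * b o ^ 2 - f o * w o * b o ^ 2 =
        (a o - b o - (1 / 2) * w o * b o) * (f o * a o)
        + (a o - b o - (1 / 2) * w o * b o) * (f o * b o)
        + (1 / 2) * (w o * b o * f o * (a o - b o)) := by ring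
    have h1 : |w o * b o * f o * (a o - b o)| ≤
        n * (M * (|f o * b o| * |a o - b o|) + (|τ o| * |f o * a o| + |τ o| * |f o * b o|)) := by
      have hm : 0 ≤ |τ o| * |f o * a o| + |τ o| * |f o * b o| := by positivity
      -- Where `w` is bounded, the factor `a - b` is kept, since it will be small in `L²`. Where `w`
      -- is large, `|f a - f b|` is bounded crudely and the tail `τ` supplies the smallness.
      rcases hw o with h | h
      · calc |w o * b o * f o * (a o - b o)| = |w o| * (|f o * b o| * |a o - b o|) := by
              simp only [abs_mul]; ring
          _ ≤ (n * M) * (|f o * b o| * |a o - b o|) := by gcongr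
          _ ≤ _ := by nlinarith [mul_nonneg hn hm]
      · calc |w o * b o * f o * (a o - b o)|
            = |w o| * b o * |f o * a o - f o * b o| := by
              rw [← mul_sub]; simp only [abs_mul, abs_of_nonneg (hb₀ o)]; ring
          _ ≤ (n * |τ o|) * (|f o * a o| + |f o * b o|) := by
              gcongr
              exact abs_sub _ _
          _ ≤ _ := by
              have : 0 ≤ n * (M * (|f o * b o| * |a o - b o|)) := by positivity
              nlinarith
    rw [e]
    refine (abs_add_le _ _).trans (add_le_add ((abs_add_le _ _).trans ?_) ?_)
    · exact add_le_add (abs_mul _ _).le (abs_mul _ _).le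
    · rw [abs_mul, abs_of_pos (by norm_num : (0 : ℝ) < 1 / 2)]
      linarith [abs_nonneg (w o * b o * f o * (a o - b o))]
  refine (integral_mono ((i1.sub i2).sub i3).abs
    ((j1.add j2).add (((j3.const_mul M).add (j4.add j5)).const_mul n)) key).trans ?_
  have e1 := integral_add (j1.add j2) (((j3.const_mul M).add (j4.add j5)).const_mul n)
  simp only [Pi.add_apply] at e1 ⊢
  rw [e1, integral_add j1 j2, integral_const_mul,
    integral_add (j3.const_mul M) (by exact j4.add j5),
    integral_const_mul]
  rw [integral_add j4 j5]
  have k1 := integral_abs_mul_le_sqrt_mul_sqrt hr hfa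
  have k2 := integral_abs_mul_le_sqrt_mul_sqrt hr hfb
  have k3 := integral_abs_mul_le_sqrt_mul_sqrt hfb hab
  have k4 := integral_abs_mul_le_sqrt_mul_sqrt hτ hfa
  have k5 := integral_abs_mul_le_sqrt_mul_sqrt hτ hfb
  exact add_le_add ((add_le_add k1 k2).trans_eq (by ring)) (mul_le_mul_of_nonneg_left
    (add_le_add (mul_le_mul_of_nonneg_left k3 hM) ((add_le_add k4 k5).trans_eq (by ring))) hn)

/-- The square root of the density of `P` with respect to `μ`. -/
noncomputable def sqrtDensity {Ω : Type*} [MeasurableSpace Ω] (P μ : Measure Ω) (o : Ω) : ℝ :=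
  √(P.rnDeriv μ o).toReal

section sqrtDensity

variable {Ω : Type*} [MeasurableSpace Ω] {P μ : Measure Ω}

theorem sqrtDensity_nonneg (o : Ω) : 0 ≤ sqrtDensity P μ o := Real.sqrt_nonneg _

theorem sqrtDensity_sq (o : Ω) : sqrtDensity P μ o ^ 2 = (P.rnDeriv μ o).toReal :=
  Real.sq_sqrt ENNReal.toReal_nonneg

theorem measurable_sqrtDensity : Measurable (sqrtDensity P μ) :=
  (Measure.measurable_rnDeriv P μ).ennreal_toReal.sqrt

variable [IsFiniteMeasure P] [SigmaFinite μ]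

theorem integral_mul_sqrtDensity_sq (h : P ≪ μ) (f : Ω → ℝ) :
    ∫ o, f o * sqrtDensity P μ o ^ 2 ∂μ = ∫ o, f o ∂P := by
  rw [← integral_rnDeriv_smul h]
  simp [sqrtDensity_sq, mul_comm]

theorem integrable_mul_sqrtDensity_sq (h : P ≪ μ) (f : Ω → ℝ) :
    Integrable (fun o => f o * sqrtDensity P μ o ^ 2) μ ↔ Integrable f P := by
  rw [← integrable_rnDeriv_smul_iff h]
  simp [sqrtDensity_sq, mul_comm]

theorem integral_mul_sqrtDensity_pow_two (h : P ≪ μ) (f : Ω → ℝ) :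
    ∫ o, (f o * sqrtDensity P μ o) ^ 2 ∂μ = ∫ o, f o ^ 2 ∂P := by
  simp only [mul_pow]
  exact integral_mul_sqrtDensity_sq h _

theorem memLp_mul_sqrtDensity (h : P ≪ μ) {f : Ω → ℝ} (hf : Measurable f) (hf2 : MemLp f 2 P) :
    MemLp (fun o => f o * sqrtDensity P μ o) 2 μ := by
  refine (memLp_two_iff_integrable_sq (hf.mul measurable_sqrtDensity).aestronglyMeasurable).2 ?_
  exact ((integrable_mul_sqrtDensity_sq h _).2 hf2.integrable_sq).congr
    (ae_of_all _ fun o => (mul_pow _ _ _).symm)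

theorem memLp_sqrtDensity (h : P ≪ μ) : MemLp (sqrtDensity P μ) 2 μ := by
  simpa using memLp_mul_sqrtDensity h (f := fun _ => 1) measurable_const (memLp_const 1)

/-- A `P`-null set is `μ`-null where the density of `P` is positive. -/
theorem mul_sqrtDensity_congr (h : P ≪ μ) {E : Type*} {f g : Ω → E} (hfg : f =ᵐ[P] g) :
    ∀ᵐ o ∂μ, sqrtDensity P μ o ≠ 0 → f o = g o := by
  rw [← Measure.withDensity_rnDeriv_eq P μ h, EventuallyEq,
    ae_withDensity_iff (Measure.measurable_rnDeriv P μ)] at hfg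
  filter_upwards [hfg] with o ho h0
  refine ho fun h1 => h0 ?_
  simp [sqrtDensity, h1]

end sqrtDensity

variable {Ω : Type*} [MeasurableSpace Ω] {k : ℕ} {P : Vec k → Measure Ω} {s s' : Ω → Vec k}

/-- In the remainder the score is always multiplied by `√p_0`, so its values off the support of `P
0` are irrelevant. This permits passing to a strongly measurable version. -/
theorem HasScore.congr (hs : HasScore P s) [IsFiniteMeasure (P 0)] (h : s =ᵐ[P 0] s') :
    HasScore P s' := by
  obtain ⟨hm, μ, hμ, hac, ho⟩ := hs
  refine ⟨hm.ae_eq h, μ, hμ, hac, ho.congr_left fun η => integral_congr_ae ?_⟩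
  filter_upwards [mul_sqrtDensity_congr hac.self_of_nhds h] with o ho
  by_cases h0 : sqrtDensity (P 0) μ o = 0
  · unfold sqrtDensity at h0; simp [h0]
  · rw [ho h0]

theorem memLp_two_of_lintegral_le {P : Measure Ω} {E : Type*} [NormedAddCommGroup E]
    {f : Ω → E} (hf : AEStronglyMeasurable f P) {C : ℝ≥0}
    (h : ∫⁻ o, ‖f o‖ₑ ^ 2 ∂P ≤ C) : MemLp f 2 P := by
  refine ⟨hf, ?_⟩
  rw [eLpNorm_lt_top_iff_lintegral_rpow_enorm_lt_top (by norm_num) (by norm_num)]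
  simpa using h.trans_lt ENNReal.coe_lt_top

theorem integral_sq_norm_le_of_lintegral_le {P : Measure Ω} {E : Type*} [NormedAddCommGroup E]
    {f : Ω → E} (hf : AEStronglyMeasurable f P) {C : ℝ≥0}
    (h : ∫⁻ o, ‖f o‖ₑ ^ 2 ∂P ≤ C) : ∫ o, ‖f o‖ ^ 2 ∂P ≤ C := by
  rw [integral_eq_lintegral_of_nonneg_ae (by filter_upwards with o; positivity)
    (by exact hf.norm.pow 2)]
  refine ENNReal.toReal_le_of_le_ofReal C.2 ?_
  simp only [ENNReal.ofReal_coe_nnreal]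
  convert h using 3 with o
  rw [ENNReal.ofReal_pow (norm_nonneg _), ofReal_norm]

/-- Second moments of the tail of a square integrable function vanish. -/
theorem exists_integral_tail_sq_le {P : Measure Ω} [IsFiniteMeasure P] {E : Type*}
    [NormedAddCommGroup E] {s : Ω → E} (hm : StronglyMeasurable s) (hs : MemLp s 2 P) {δ : ℝ} (hδ : 0 < δ) :
    ∃ M : ℝ, 0 ≤ M ∧ ∫ o, {o | M < ‖s o‖}.indicator (fun o => ‖s o‖) o ^ 2 ∂P ≤ δ := by
  have hmeas : ∀ M : ℝ, MeasurableSet {o | M < ‖s o‖} :=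
    fun M => measurableSet_lt measurable_const hm.norm.measurable
  have ht : Tendsto (fun n : ℕ => ∫ o, {o | (n : ℝ) < ‖s o‖}.indicator (fun o => ‖s o‖) o ^ 2 ∂P)
      atTop (𝓝 (∫ _, (0 : ℝ) ∂P)) := by
    refine tendsto_integral_of_dominated_convergence (fun o => ‖s o‖ ^ 2) ?_
      hs.integrable_norm_pow' ?_ ?_
    · intro n
      exact ((hm.norm.indicator (hmeas n)).pow 2).aestronglyMeasurable
    · intro n
      filter_upwards with o
      by_cases h : (n : ℝ) < ‖s o‖
      · simp [Set.indicator, h]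
      · simp [Set.indicator, h]
    · filter_upwards with o
      refine tendsto_const_nhds.congr' ?_
      filter_upwards [eventually_ge_atTop ⌈‖s o‖⌉₊] with n hn
      have : ¬ (n : ℝ) < ‖s o‖ := not_lt.2 (Nat.ceil_le.1 hn)
      simp [Set.indicator, this]
  rw [integral_zero] at ht
  obtain ⟨n, hn⟩ := ((tendsto_order.1 ht).2 δ hδ).exists
  exact ⟨n, n.cast_nonneg, hn.le⟩

end MissingLabel

namespace MissingLabel

variable {Ω : Type*} [MeasurableSpace Ω] {k : ℕ} {P : Vec k → Measure Ω} {s : Ω → Vec k}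

/-- The difference of means is `∫ f (p_η - p_0)`, controlled by Cauchy-Schwarz in terms of the
quadratic mean remainder. Only the second moments of `f` enter, whence uniformity in `i`. The cross
term `f ⟨s, η⟩ √p_0 (√p_η - √p_0)` has several unbounded factors, so the score is cut at a level
`M`. -/
theorem HasScore.expansion_of_stronglyMeasurable (hs : HasScore P s) (hsm : StronglyMeasurable s)
    (hP : ∀ᶠ η in 𝓝 0, IsProbabilityMeasure (P η)) {ι : Type*} {f : ι → Ω → ℝ}
    (hf : ∀ i, Measurable (f i)) {C : ℝ≥0}
    (hC : ∀ᶠ η in 𝓝 0, ∀ i, ∫⁻ o, ‖f i o‖ₑ ^ 2 ∂(P η) ≤ C) {ε : ℝ} (hε : 0 < ε) :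
    ∀ᶠ η in 𝓝 0, ∀ i, |∫ o, f i o ∂(P η) - ∫ o, f i o ∂(P 0)
      - ∫ o, f i o * ⟪s o, η⟫_ℝ ∂(P 0)| ≤ ε * ‖η‖ := by
  have hP0 := hP.self_of_nhds
  obtain ⟨hm, μ, hμ, hac, ho⟩ := hs
  have hac0 := hac.self_of_nhds
  set K := √(C : ℝ) with hK
  have hK0 : 0 ≤ K := Real.sqrt_nonneg _
  -- The final bound is `‖η‖ (4 K c + M K c')`. Here `c` bounds both the quadratic mean remainder
  -- (relative to `‖η‖`) and the tail of the score; `c'` bounds the `L²` norm of `√p_η - √p_0` and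
  -- is chosen after `M`, which depends on `c`.
  set c := ε / (8 * (K + 1)) with hc
  have hc0 : 0 < c := by positivity
  have hcK : K * c ≤ ε / 8 := by
    rw [hc, ← mul_div_assoc, div_le_iff₀ (by positivity)]
    nlinarith
  obtain ⟨M, hM, hMt⟩ := exists_integral_tail_sq_le hsm hm (δ := c ^ 2) (by positivity)
  set t : Ω → ℝ := {o | M < ‖s o‖}.indicator (fun o => ‖s o‖) with ht
  have htm : Measurable t :=
    hsm.norm.measurable.indicator (measurableSet_lt measurable_const hsm.norm.measurable)
  have ht2 : MemLp t 2 (P 0) :=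
    hm.norm.indicator (measurableSet_lt measurable_const hsm.norm.measurable)
  set c' := ε / (4 * (M * K + 1)) with hc'
  have hMK : 0 ≤ M * K := by positivity
  have hc'0 : 0 < c' := by positivity
  have hcM : M * K * c' ≤ ε / 4 := by
    rw [hc', ← mul_div_assoc, div_le_iff₀ (by positivity)]
    nlinarith
  set S := ∫ o, ‖s o‖ ^ 2 ∂(P 0) with hS
  -- This quantity dominates `∫ (√p_η - √p_0)²`, by `(x + y)² ≤ 2x² + 2y²` with `x` the remainder
  -- and `y = ⟨s, η⟩ √p_0 / 2`.
  have hlim : Tendsto (fun η : Vec k => ‖η‖ ^ 2 * (2 * c ^ 2 + S / 2)) (𝓝 0) (𝓝 0) := by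
    have : Continuous fun η : Vec k => ‖η‖ ^ 2 * (2 * c ^ 2 + S / 2) := by fun_prop
    simpa using this.tendsto 0
  filter_upwards [hP, hC, hac, ho.bound (by positivity : 0 < c ^ 2),
    (tendsto_order.1 hlim).2 (c' ^ 2) (by positivity)] with η hPη hCη hacη hr hη i
  have hb := memLp_sqrtDensity hac0
  have ha := memLp_sqrtDensity hacη
  have hw2 : MemLp (fun o => ⟪s o, η⟫_ℝ) 2 (P 0) := hm.inner_const η
  have hwm : Measurable (fun o => ⟪s o, η⟫_ℝ) := (hsm.inner stronglyMeasurable_const).measurable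
  have hwb := memLp_mul_sqrtDensity hac0 hwm hw2
  have hfa := memLp_mul_sqrtDensity hacη (hf i)
    (memLp_two_of_lintegral_le (hf i).aestronglyMeasurable (hCη i))
  have hfb := memLp_mul_sqrtDensity hac0 (hf i)
    (memLp_two_of_lintegral_le (hf i).aestronglyMeasurable (hC.self_of_nhds i))
  have hτ := memLp_mul_sqrtDensity hac0 htm ht2
  have main := abs_integral_expansion_le (n := ‖η‖) hM (norm_nonneg _) ha hb hwb hfa hfb hτ
    (fun o => sqrtDensity_nonneg o) (by
      intro o
      have h1 : |⟪s o, η⟫_ℝ| ≤ ‖s o‖ * ‖η‖ := abs_real_inner_le_norm _ _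
      by_cases h : M < ‖s o‖
      · right
        rw [abs_mul, abs_of_nonneg (sqrtDensity_nonneg o)]
        have : t o = ‖s o‖ := by simp [ht, h]
        rw [this, abs_norm, ← mul_assoc, mul_comm ‖η‖]
        exact mul_le_mul_of_nonneg_right h1 (sqrtDensity_nonneg o)
      · left
        refine h1.trans ?_
        rw [mul_comm]
        exact mul_le_mul_of_nonneg_left (not_lt.1 h) (norm_nonneg _))
  rw [integral_mul_sqrtDensity_sq hacη, integral_mul_sqrtDensity_sq hac0,
    integral_mul_sqrtDensity_sq hac0 (fun o => f i o * ⟪s o, η⟫_ℝ),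
    integral_mul_sqrtDensity_pow_two hacη, integral_mul_sqrtDensity_pow_two hac0,
    integral_mul_sqrtDensity_pow_two hac0] at main
  refine main.trans ?_
  have hr' : ∫ o, (sqrtDensity (P η) μ o - sqrtDensity (P 0) μ o
      - (1 / 2) * ⟪s o, η⟫_ℝ * sqrtDensity (P 0) μ o) ^ 2 ∂μ ≤ c ^ 2 * ‖η‖ ^ 2 := by
    have := (le_abs_self _).trans hr
    simpa [sqrtDensity] using this
  have e1 : √(∫ o, f i o ^ 2 ∂(P η)) ≤ K := by
    refine Real.sqrt_le_sqrt ?_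
    simpa using integral_sq_norm_le_of_lintegral_le (hf i).aestronglyMeasurable (hCη i)
  have e2 : √(∫ o, f i o ^ 2 ∂(P 0)) ≤ K := by
    refine Real.sqrt_le_sqrt ?_
    simpa using integral_sq_norm_le_of_lintegral_le (hf i).aestronglyMeasurable
      (hC.self_of_nhds i)
  have e3 : √(∫ o, t o ^ 2 ∂(P 0)) ≤ c := Real.sqrt_le_iff.2 ⟨hc0.le, hMt⟩
  have e4 : √(∫ o, (sqrtDensity (P η) μ o - sqrtDensity (P 0) μ o
      - (1 / 2) * ⟪s o, η⟫_ℝ * sqrtDensity (P 0) μ o) ^ 2 ∂μ) ≤ c * ‖η‖ :=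
    Real.sqrt_le_iff.2 ⟨by positivity, by rw [mul_pow]; exact hr'⟩
  have e5 : √(∫ o, (sqrtDensity (P η) μ o - sqrtDensity (P 0) μ o) ^ 2 ∂μ) ≤ c' := by
    refine Real.sqrt_le_iff.2 ⟨hc'0.le, le_trans ?_ hη.le⟩
    have i1 : Integrable (fun o => (sqrtDensity (P η) μ o - sqrtDensity (P 0) μ o
      - (1 / 2) * ⟪s o, η⟫_ℝ * sqrtDensity (P 0) μ o) ^ 2) μ := by
      have : MemLp (fun o => sqrtDensity (P η) μ o - sqrtDensity (P 0) μ o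
          - (1 / 2) * ⟪s o, η⟫_ℝ * sqrtDensity (P 0) μ o) 2 μ := by
        convert (ha.sub hb).sub (hwb.const_mul (1 / 2)) using 2 with o
        simp [mul_assoc]
      exact this.integrable_sq
    have i2 : Integrable (fun o => (‖s o‖ * sqrtDensity (P 0) μ o) ^ 2) μ :=
      (memLp_mul_sqrtDensity hac0 hsm.norm.measurable hm.norm).integrable_sq
    have i3 : Integrable (fun o => (sqrtDensity (P η) μ o - sqrtDensity (P 0) μ o) ^ 2) μ :=
      (ha.sub hb).integrable_sq
    calc ∫ o, (sqrtDensity (P η) μ o - sqrtDensity (P 0) μ o) ^ 2 ∂μ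
        ≤ ∫ o, (2 * (sqrtDensity (P η) μ o - sqrtDensity (P 0) μ o
            - (1 / 2) * ⟪s o, η⟫_ℝ * sqrtDensity (P 0) μ o) ^ 2
            + ‖η‖ ^ 2 / 2 * (‖s o‖ * sqrtDensity (P 0) μ o) ^ 2) ∂μ := by
          refine integral_mono i3 ((i1.const_mul 2).add (i2.const_mul _)) fun o => ?_
          have h1 : ⟪s o, η⟫_ℝ ^ 2 ≤ (‖s o‖ * ‖η‖) ^ 2 :=
            sq_le_sq' (neg_le_of_abs_le (abs_real_inner_le_norm _ _))
              (le_of_abs_le (abs_real_inner_le_norm _ _))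
          have h2 : ⟪s o, η⟫_ℝ ^ 2 * sqrtDensity (P 0) μ o ^ 2 ≤
              (‖s o‖ * ‖η‖) ^ 2 * sqrtDensity (P 0) μ o ^ 2 := by gcongr
          dsimp only
          nlinarith [sq_nonneg (sqrtDensity (P η) μ o - sqrtDensity (P 0) μ o
            - ⟪s o, η⟫_ℝ * sqrtDensity (P 0) μ o)]
      _ = 2 * ∫ o, (sqrtDensity (P η) μ o - sqrtDensity (P 0) μ o
            - (1 / 2) * ⟪s o, η⟫_ℝ * sqrtDensity (P 0) μ o) ^ 2 ∂μ
            + ‖η‖ ^ 2 / 2 * S := by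
          rw [integral_add (i1.const_mul 2) (i2.const_mul _), integral_const_mul,
            integral_const_mul, integral_mul_sqrtDensity_pow_two hac0]
      _ ≤ ‖η‖ ^ 2 * (2 * c ^ 2 + S / 2) := by linarith
  calc _ ≤ (c * ‖η‖) * (K + K) + ‖η‖ * (M * (K * c') + c * (K + K)) := by gcongr
    _ = ‖η‖ * (4 * (K * c) + M * K * c') := by ring
    _ ≤ ‖η‖ * ε := by gcongr; linarith
    _ = ε * ‖η‖ := mul_comm _ _

/-- Means of functions with bounded second moments have a first order expansion along a family
that is differentiable in quadratic mean, uniformly over such functions. -/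
theorem HasScore.expansion (hs : HasScore P s)
    (hP : ∀ᶠ η in 𝓝 0, IsProbabilityMeasure (P η)) {ι : Type*} {f : ι → Ω → ℝ}
    (hf : ∀ i, Measurable (f i)) {C : ℝ≥0}
    (hC : ∀ᶠ η in 𝓝 0, ∀ i, ∫⁻ o, ‖f i o‖ₑ ^ 2 ∂(P η) ≤ C) {ε : ℝ} (hε : 0 < ε) :
    ∀ᶠ η in 𝓝 0, ∀ i, |∫ o, f i o ∂(P η) - ∫ o, f i o ∂(P 0)
      - ∫ o, f i o * ⟪s o, η⟫_ℝ ∂(P 0)| ≤ ε * ‖η‖ := by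
  have hP0 := hP.self_of_nhds
  have hmk := hs.1.1.ae_eq_mk
  filter_upwards [(hs.congr hmk).expansion_of_stronglyMeasurable hs.1.1.stronglyMeasurable_mk
    hP hf hC hε] with η h i
  have e : ∫ o, f i o * ⟪s o, η⟫_ℝ ∂(P 0) = ∫ o, f i o * ⟪hs.1.1.mk s o, η⟫_ℝ ∂(P 0) := by
    refine integral_congr_ae ?_
    filter_upwards [hmk] with o ho
    rw [← ho]
  rw [e]
  exact h i

/-- A function whose mean is constant along the family is uncorrelated with the score. -/
theorem HasScore.integral_mul_eq_zero (hs : HasScore P s)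
    (hP : ∀ᶠ η in 𝓝 0, IsProbabilityMeasure (P η)) {f : Ω → ℝ}
    (hf : Measurable f) {C : ℝ≥0}
    (hC : ∀ᶠ η in 𝓝 0, ∫⁻ o, ‖f o‖ₑ ^ 2 ∂(P η) ≤ C)
    (h0 : ∀ᶠ η in 𝓝 0, ∫ o, f o ∂(P η) = ∫ o, f o ∂(P 0)) (v : Vec k) :
    ∫ o, f o * ⟪s o, v⟫_ℝ ∂(P 0) = 0 := by
  by_contra hne
  have hv : Tendsto (fun t : ℝ => t • v) (𝓝[>] 0) (𝓝 0) := by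
    have : Continuous fun t : ℝ => t • v := by fun_prop
    simpa using (this.tendsto 0).mono_left nhdsWithin_le_nhds
  set I := ∫ o, f o * ⟪s o, v⟫_ℝ ∂(P 0) with hI
  have hI0 : 0 < |I| := abs_pos.2 hne
  -- At `t v` the expansion reads `t |I| ≤ ε t ‖v‖`; this `ε` makes `ε ‖v‖ < |I|`, a contradiction.
  have h1 := hs.expansion hP (f := fun _ : Unit => f) (fun _ => hf) (C := C)
    (by simpa using hC) (ε := |I| / (2 * (‖v‖ + 1))) (by positivity)
  obtain ⟨t, ⟨ht1, ht2⟩, ht⟩ :=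
    ((hv.eventually (h1.and h0)).and self_mem_nhdsWithin).exists
  replace ht : 0 < t := ht
  have h2 := ht1 ()
  rw [ht2, sub_self, zero_sub, abs_neg, norm_smul, Real.norm_of_nonneg ht.le] at h2
  have h3 : ∫ o, f o * ⟪s o, t • v⟫_ℝ ∂(P 0) = t * I := by
    rw [hI, ← integral_const_mul]
    congr 1 with o
    rw [inner_smul_right]; ring
  rw [h3, abs_mul, abs_of_pos ht] at h2
  have h4 : |I| ≤ |I| / (2 * (‖v‖ + 1)) * ‖v‖ := by
    refine le_of_mul_le_mul_left (h2.trans_eq ?_) ht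
    ring
  rw [div_mul_eq_mul_div, le_div_iff₀ (by positivity)] at h4
  nlinarith [norm_nonneg v]

/-- Vector valued version of `HasScore.expansion`. -/
theorem HasScore.expansion_vec (hs : HasScore P s)
    (hP : ∀ᶠ η in 𝓝 0, IsProbabilityMeasure (P η)) {q : ℕ} {ι : Type*} {f : ι → Ω → Vec q}
    (hf : ∀ i, Measurable (f i)) {C : ℝ≥0}
    (hC : ∀ᶠ η in 𝓝 0, ∀ i, ∫⁻ o, ‖f i o‖ₑ ^ 2 ∂(P η) ≤ C) {ε : ℝ} (hε : 0 < ε) :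
    ∀ᶠ η in 𝓝 0, ∀ i, ‖∫ o, f i o ∂(P η) - ∫ o, f i o ∂(P 0)
      - ∫ o, ⟪s o, η⟫_ℝ • f i o ∂(P 0)‖ ≤ ε * ‖η‖ := by
  have hP0 := hP.self_of_nhds
  -- Adjoining the unit ball to the index set makes the scalar expansion uniform over directions, so
  -- the direction may be that of the remainder itself, which varies with `η`.
  have h := hs.expansion hP (ι := ι × {e : Vec q // ‖e‖ ≤ 1}) 
    (f := fun i o => ⟪(i.2 : Vec q), f i.1 o⟫_ℝ)
    (fun i => (measurable_const.inner (hf i.1))) (C := C) (by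
      filter_upwards [hC] with η hη i
      refine le_trans (lintegral_mono fun o => ?_) (hη i.1)
      gcongr
      rw [enorm_le_iff_norm_le]
      refine (norm_inner_le_norm _ _).trans ?_
      exact mul_le_of_le_one_left (norm_nonneg _) i.2.2) hε
  filter_upwards [h, hP, hC] with η hη hPη hCη i
  set x := ∫ o, f i o ∂(P η) - ∫ o, f i o ∂(P 0) - ∫ o, ⟪s o, η⟫_ℝ • f i o ∂(P 0) with hx
  rcases eq_or_ne x 0 with h0 | h0
  · rw [h0, norm_zero]; positivity
  have hx0 : 0 < ‖x‖ := norm_pos_iff.2 h0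
  have h1 := hη (i, ⟨‖x‖⁻¹ • x, by
    rw [norm_smul, norm_inv, norm_norm, inv_mul_cancel₀ hx0.ne']⟩)
  have m1 := memLp_two_of_lintegral_le (hf i).aestronglyMeasurable (hCη i)
  have m0 := memLp_two_of_lintegral_le (hf i).aestronglyMeasurable (hC.self_of_nhds i)
  have ms : MemLp (fun o => ⟪s o, η⟫_ℝ) 2 (P 0) := hs.1.inner_const η
  have e : ∀ e : Vec q, ∫ o, ⟪e, f i o⟫_ℝ ∂(P η) - ∫ o, ⟪e, f i o⟫_ℝ ∂(P 0)
      - ∫ o, ⟪e, f i o⟫_ℝ * ⟪s o, η⟫_ℝ ∂(P 0) = ⟪e, x⟫_ℝ := by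
    intro e
    rw [hx, inner_sub_right, inner_sub_right,
      integral_inner (m1.integrable one_le_two), integral_inner (m0.integrable one_le_two),
      ← integral_inner (f := fun o => ⟪s o, η⟫_ℝ • f i o)
        (by exact (m0.smul ms).integrable le_rfl)]
    congr 2 with o
    simp [inner_smul_right, mul_comm]
  dsimp only at h1
  rw [e, real_inner_smul_left, real_inner_self_eq_norm_sq, pow_two, ← mul_assoc,
    inv_mul_cancel₀ hx0.ne', one_mul, abs_norm] at h1
  exact h1

theorem norm_integral_inner_smul_le {P : Measure Ω} {q : ℕ} {s : Ω → Vec k} {f : Ω → Vec q}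
    (hs : MemLp s 2 P) (hf : MemLp f 2 P) (η : Vec k) :
    ‖∫ o, ⟪s o, η⟫_ℝ • f o ∂P‖ ≤
      √(∫ o, ‖s o‖ ^ 2 ∂P) * √(∫ o, ‖f o‖ ^ 2 ∂P) * ‖η‖ := by
  have h1 := integral_abs_mul_le_sqrt_mul_sqrt hs.norm hf.norm
  have h2 := integrable_abs_mul_of_memLp hs.norm hf.norm
  simp only [abs_norm] at h1 h2
  calc ‖∫ o, ⟪s o, η⟫_ℝ • f o ∂P‖ ≤ ∫ o, ‖s o‖ * ‖f o‖ * ‖η‖ ∂P := by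
        refine norm_integral_le_of_norm_le (h2.mul_const _) (ae_of_all _ fun o => ?_)
        rw [norm_smul]
        calc _ ≤ (‖s o‖ * ‖η‖) * ‖f o‖ := by gcongr; exact norm_inner_le_norm _ _
          _ = _ := by ring
    _ ≤ _ := by rw [integral_mul_const]; gcongr

end MissingLabel

/-! ### Roots of estimating equations, and conditional means -/

namespace MissingLabel

/-- Expanding `m` at `t η` gives `T (t η - t₀) = G η + o(t η - t₀) + o(η)`. Applying `T'` first
shows `t η - t₀ = O(η)`, and then both errors are `o(η)`. -/
theorem hasFDerivAt_of_root {E F : Type*} [NormedAddCommGroup E] [NormedSpace ℝ E]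
    [NormedAddCommGroup F] [NormedSpace ℝ F] {m : F → F} {T T' : F →L[ℝ] F} {t : E → F} {t₀ : F}
    {G : E →L[ℝ] F} (hT : ∀ x, T' (T x) = x) (ht₀ : t 0 = t₀) (ht : Tendsto t (𝓝 0) (𝓝 t₀))
    (hm : HasFDerivAt m (-T) t₀) (hm₀ : m t₀ = 0)
    (hG : (fun η => m (t η) + G η) =o[𝓝 0] fun η => η) :
    HasFDerivAt t (T'.comp G) 0 := by
  have h1 : (fun η => m (t η) + T (t η - t₀)) =o[𝓝 0] fun η => t η - t₀ := by
    have := hm.isLittleO.comp_tendsto ht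
    refine this.congr_left fun η => ?_
    simp [hm₀]
    abel
  have h2 : (fun η => T' (m (t η) + T (t η - t₀))) =o[𝓝 0] fun η => t η - t₀ :=
    (T'.isBigO_comp _ _).trans_isLittleO h1
  have h3 : (fun η => T' (m (t η) + G η)) =o[𝓝 0] fun η => η :=
    (T'.isBigO_comp _ _).trans_isLittleO hG
  have h4 : (fun η => t η - t₀) =O[𝓝 0] fun η => η := by
    refine h2.right_isBigO_sub.trans ?_
    have e : (fun η => (t η - t₀) - T' (m (t η) + T (t η - t₀))) =
        fun η => (T'.comp G) η - T' (m (t η) + G η) := by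
      funext η
      simp only [map_add, hT, ContinuousLinearMap.comp_apply]
      abel
    rw [e]
    exact ((T'.comp G).isBigO_id _).sub h3.isBigO
  rw [hasFDerivAt_iff_isLittleO]
  simp only [sub_zero, ht₀]
  refine ((h2.trans_isBigO h4).sub h3).congr_left fun η => ?_
  simp only [map_add, hT, ContinuousLinearMap.comp_apply]
  abel

theorem toEuclideanCLM_inv_apply {q : ℕ} {A : Matrix (Fin q) (Fin q) ℝ} (hA : IsUnit A.det)
    (x : Vec q) :
    Matrix.toEuclideanCLM (𝕜 := ℝ) A⁻¹ (Matrix.toEuclideanCLM (𝕜 := ℝ) A x) = x := by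
  rw [← mul_apply_eq_comp, ← map_mul, Matrix.nonsing_inv_mul A hA, map_one]
  rfl

/-- The norm of `m` attains its minimum on the compact set `Θ \ interior U`, where `m` has no zero.
It serves both for consistency and for excluding remote roots. -/
theorem exists_pos_le_norm_of_root {E F : Type*} [TopologicalSpace E] [NormedAddCommGroup F]
    {Θ U : Set E} {m : E → F} {t₀ : E} (hΘ : IsCompact Θ) (hm : ContinuousOn m Θ)
    (hroot : ∀ θ ∈ Θ, m θ = 0 ↔ θ = t₀) (hU : U ∈ 𝓝 t₀) :
    ∃ δ > 0, ∀ θ ∈ Θ, θ ∉ U → δ ≤ ‖m θ‖ := by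
  have hK : IsCompact (Θ \ interior U) := hΘ.diff isOpen_interior
  have ht₀ : t₀ ∈ interior U := mem_interior_iff_mem_nhds.2 hU
  rcases (Θ \ interior U).eq_empty_or_nonempty with h | h
  · refine ⟨1, one_pos, fun θ hθ hθU => ?_⟩
    exact absurd (h ▸ ⟨hθ, fun h' => hθU (interior_subset h')⟩ : θ ∈ (∅ : Set E)) (by simp)
  · obtain ⟨x, hx, hmin⟩ := hK.exists_isMinOn h (hm.mono Set.sdiff_subset).norm
    refine ⟨‖m x‖, norm_pos_iff.2 fun h0 => hx.2 ?_, fun θ hθ hθU => hmin ⟨hθ, fun h' =>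
      hθU (interior_subset h')⟩⟩
    rw [(hroot x hx.1).1 h0]
    exact ht₀

variable {d q : ℕ} {Z : Type*} [MeasurableSpace Z]

theorem memLp_two_of_lintegral_lt_top {Ω : Type*} [MeasurableSpace Ω] {P : Measure Ω}
    {E : Type*} [NormedAddCommGroup E]
    {f : Ω → E} (hf : AEStronglyMeasurable f P) (h : ∫⁻ o, ‖f o‖ₑ ^ 2 ∂P < ∞) : MemLp f 2 P :=
  memLp_two_of_lintegral_le (C := (∫⁻ o, ‖f o‖ₑ ^ 2 ∂P).toNNReal) hf
    (ENNReal.coe_toNNReal h.ne).ge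

theorem lintegral_sq_lt_top_of_memLp {Ω : Type*} [MeasurableSpace Ω] {P : Measure Ω}
    {E : Type*} [NormedAddCommGroup E]
    {f : Ω → E} (hf : MemLp f 2 P) : ∫⁻ o, ‖f o‖ₑ ^ 2 ∂P < ∞ := by
  have := (eLpNorm_lt_top_iff_lintegral_rpow_enorm_lt_top (by norm_num) (by norm_num)).1 hf.2
  simpa using this

theorem memLp_obsLaw {E : Type*} [NormedAddCommGroup E] [MeasurableSpace E] [BorelSpace E]
    [SecondCountableTopology E] {π : ℝ} {Q : Measure (FullDatum d Z)} [SFinite Q]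
    {f : ObsDatum d Z → E} (hf : Measurable f) (h₁ : MemLp (fun u => f (seen u)) 2 Q)
    (h₂ : MemLp (fun u => f (unseen u)) 2 Q) : MemLp f 2 (obsLaw π Q) := by
  refine memLp_two_of_lintegral_lt_top hf.aestronglyMeasurable ?_
  rw [lintegral_obsLaw π Q (by fun_prop)]
  exact ENNReal.add_lt_top.2
    ⟨ENNReal.mul_lt_top ENNReal.ofReal_lt_top (lintegral_sq_lt_top_of_memLp h₁),
      ENNReal.mul_lt_top ENNReal.ofReal_lt_top (lintegral_sq_lt_top_of_memLp h₂)⟩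

/-- The conditional mean of `f` given `(X, Z)`. -/
noncomputable def fiberMean {E : Type*} [NormedAddCommGroup E] [NormedSpace ℝ E]
    (Q : Measure (FullDatum d Z)) [IsFiniteMeasure Q] (f : FullDatum d Z → E) (w : Vec d × Z) :
    E :=
  ∫ y, f (w, y) ∂(Q.condKernel w)

section fiberMean

variable {E : Type*} [NormedAddCommGroup E] [NormedSpace ℝ E] {Q : Measure (FullDatum d Z)}
  [IsProbabilityMeasure Q] {f : FullDatum d Z → E}

theorem stronglyMeasurable_fiberMean (hf : StronglyMeasurable f) :
    StronglyMeasurable (fiberMean Q f) :=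
  hf.integral_kernel_prod_right'

/-- Jensen's inequality on each fibre, as the comparison of `L¹` and `L²` norms for a probability
measure, followed by disintegration. -/
theorem lintegral_fiberMean_sq_le (hf : StronglyMeasurable f) :
    ∫⁻ u, ‖fiberMean Q f u.1‖ₑ ^ 2 ∂Q ≤ ∫⁻ u, ‖f u‖ₑ ^ 2 ∂Q := by
  have e : ∫⁻ u, ‖fiberMean Q f u.1‖ₑ ^ 2 ∂Q = ∫⁻ w, ‖fiberMean Q f w‖ₑ ^ 2 ∂Q.fst := by
    rw [Measure.fst, lintegral_map ((stronglyMeasurable_fiberMean hf).enorm.pow_const 2)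
      measurable_fst]
  rw [e, ← Measure.lintegral_condKernel (hf.enorm.pow_const 2)]
  refine lintegral_mono fun w => ?_
  have h1 : ‖fiberMean Q f w‖ₑ ≤ ∫⁻ y, ‖f (w, y)‖ₑ ∂(Q.condKernel w) :=
    enorm_integral_le_lintegral_enorm _
  have hm : AEStronglyMeasurable (fun y => f (w, y)) (Q.condKernel w) :=
    (hf.comp_measurable measurable_prodMk_left).aestronglyMeasurable
  have h2 := eLpNorm_le_eLpNorm_of_exponent_le (p := 1) (q := 2) one_le_two hm
  rw [eLpNorm_one_eq_lintegral_enorm,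
    eLpNorm_eq_lintegral_rpow_enorm_toReal (by norm_num) (by norm_num)] at h2
  calc ‖fiberMean Q f w‖ₑ ^ 2
      ≤ ((∫⁻ y, ‖f (w, y)‖ₑ ^ (2 : ℝ≥0∞).toReal ∂(Q.condKernel w))
          ^ (1 / (2 : ℝ≥0∞).toReal)) ^ 2 := by
        gcongr; exact h1.trans h2
    _ = _ := by
        rw [← ENNReal.rpow_natCast, ← ENNReal.rpow_mul]
        simp

theorem memLp_fiberMean (hf : StronglyMeasurable f) (hf2 : MemLp f 2 Q) :
    MemLp (fun u => fiberMean Q f u.1) 2 Q :=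
  memLp_two_of_lintegral_lt_top
    ((stronglyMeasurable_fiberMean hf).comp_measurable measurable_fst).aestronglyMeasurable
    ((lintegral_fiberMean_sq_le hf).trans_lt (lintegral_sq_lt_top_of_memLp hf2))

theorem integral_fiberMean (hf : Integrable f Q) (hm : StronglyMeasurable f) :
    ∫ u, fiberMean Q f u.1 ∂Q = ∫ u, f u ∂Q := by
  have e := integral_map (μ := Q) measurable_fst.aemeasurable
    (stronglyMeasurable_fiberMean (Q := Q) hm).aestronglyMeasurable
  rw [← Measure.integral_condKernel hf, ← e]
  rfl

end fiberMean

end MissingLabel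

/-! ### Inverse weighting, augmentation, and orthogonality to scores -/

namespace MissingLabel

section truncate

variable {Ω : Type*}

/-- The function that agrees with `f` where `|f| ≤ n` and vanishes elsewhere. -/
noncomputable def truncate (f : Ω → ℝ) (n : ℕ) (o : Ω) : ℝ := if |f o| ≤ n then f o else 0

theorem measurable_truncate [MeasurableSpace Ω] {f : Ω → ℝ} (hf : Measurable f) (n : ℕ) :
    Measurable (truncate f n) :=
  Measurable.ite (measurableSet_le (by fun_prop) measurable_const) hf measurable_const

theorem abs_truncate_le (f : Ω → ℝ) (n : ℕ) (o : Ω) : |truncate f n o| ≤ n := by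
  unfold truncate; split <;> simp_all

theorem abs_truncate_le_abs (f : Ω → ℝ) (n : ℕ) (o : Ω) : |truncate f n o| ≤ |f o| := by
  unfold truncate; split <;> simp

theorem eventually_truncate_eq (f : Ω → ℝ) (o : Ω) : ∀ᶠ n in atTop, truncate f n o = f o := by
  filter_upwards [eventually_ge_atTop ⌈|f o|⌉₊] with n hn
  have : |f o| ≤ n := Nat.ceil_le.1 hn
  simp [truncate, this]

end truncate

variable {d q : ℕ} {Z : Type*}

section weighting

variable {E : Type*} [NormedAddCommGroup E] [NormedSpace ℝ E]

/-- The inverse probability weighted version of a function of the full datum. -/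
noncomputable def ipw (π : ℝ) (f : FullDatum d Z → E) (o : ObsDatum d Z) : E :=
  (if o.1 then π⁻¹ else 0) • f o.2

/-- The augmentation term built from a function of the covariates. -/
noncomputable def augment (π : ℝ) (g : Vec d × Z → E) (o : ObsDatum d Z) : E :=
  (1 - if o.1 then π⁻¹ else 0) • g o.2.1

variable {π : ℝ}

theorem ipw_seen (f : FullDatum d Z → E) (u : FullDatum d Z) :
    ipw π f (seen u) = π⁻¹ • f u := by simp [ipw, seen]

theorem ipw_unseen (f : FullDatum d Z → E) (u : FullDatum d Z) :
    ipw π f (unseen u) = 0 := by simp [ipw, unseen]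

theorem augment_seen (g : Vec d × Z → E) (u : FullDatum d Z) :
    augment π g (seen u) = (1 - π⁻¹) • g u.1 := by simp [augment, seen]

theorem augment_unseen (g : Vec d × Z → E) (u : FullDatum d Z) :
    augment π g (unseen u) = g u.1 := by simp [augment, unseen]

variable [MeasurableSpace Z] [MeasurableSpace E] [BorelSpace E] [SecondCountableTopology E]

theorem measurable_weight : Measurable (fun o : ObsDatum d Z => if o.1 then π⁻¹ else (0 : ℝ)) :=
  Measurable.ite (measurable_fst (measurableSet_singleton true)) measurable_const measurable_const

theorem measurable_ipw {f : FullDatum d Z → E} (hf : Measurable f) : Measurable (ipw π f) :=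
  measurable_weight.smul (hf.comp measurable_snd)

theorem measurable_augment {g : Vec d × Z → E} (hg : Measurable g) :
    Measurable (augment π g : ObsDatum d Z → E) :=
  (measurable_const.sub measurable_weight).smul (hg.comp (measurable_fst.comp measurable_snd))

theorem integral_ipw (h₀ : 0 < π) (h₁ : π < 1) {Q : Measure (FullDatum d Z)} [SFinite Q]
    {f : FullDatum d Z → E} (hf : Measurable f) (hfi : Integrable f Q) :
    ∫ o, ipw π f o ∂(obsLaw π Q) = ∫ u, f u ∂Q := by
  have hi : Integrable (ipw π f) (obsLaw π Q) := by
    rw [integrable_obsLaw_iff h₀ h₁ (measurable_ipw hf).aestronglyMeasurable]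
    simp only [ipw_seen, ipw_unseen]
    exact ⟨hfi.smul _, integrable_zero _ _ _⟩
  rw [integral_obsLaw h₀ h₁ hi]
  simp only [ipw_seen, ipw_unseen]
  rw [integral_smul, integral_zero, smul_zero, add_zero, smul_smul, mul_inv_cancel₀ h₀.ne',
    one_smul]

/-- The factor is `π · π⁻²`. As it does not depend on `Q`, uniform moment bounds for `ψ` along a
submodel pass to the observed data. -/
theorem lintegral_ipw_sq (h₀ : 0 < π) {Q : Measure (FullDatum d Z)} [SFinite Q]
    {f : FullDatum d Z → E} (hf : Measurable f) :
    ∫⁻ o, ‖ipw π f o‖ₑ ^ 2 ∂(obsLaw π Q) = ENNReal.ofReal π⁻¹ * ∫⁻ u, ‖f u‖ₑ ^ 2 ∂Q := by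
  rw [lintegral_obsLaw π Q ((measurable_ipw hf).enorm.pow_const 2)]
  simp only [ipw_seen, ipw_unseen, enorm_smul, mul_pow]
  rw [lintegral_const_mul _ (hf.enorm.pow_const 2)]
  have : ‖π⁻¹‖ₑ = ENNReal.ofReal π⁻¹ := Real.enorm_of_nonneg (by positivity)
  rw [this, ← mul_assoc]
  have h2 : ENNReal.ofReal π * ENNReal.ofReal π⁻¹ ^ 2 = ENNReal.ofReal π⁻¹ := by
    rw [← ENNReal.ofReal_pow (by positivity), ← ENNReal.ofReal_mul h₀.le]
    congr 1
    field_simp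
  simp [h2]

theorem memLp_ipw {Q : Measure (FullDatum d Z)} [SFinite Q]
    {f : FullDatum d Z → E} (hf : Measurable f) (hf2 : MemLp f 2 Q) :
    MemLp (ipw π f) 2 (obsLaw π Q) := by
  refine memLp_obsLaw (measurable_ipw hf) ?_ ?_
  · simp only [ipw_seen]; exact hf2.const_smul _
  · simp only [ipw_unseen]; exact MemLp.zero

theorem memLp_augment {Q : Measure (FullDatum d Z)} [SFinite Q]
    {g : Vec d × Z → E} (hg : Measurable g) (hg2 : MemLp (fun u : FullDatum d Z => g u.1) 2 Q) :
    MemLp (augment π g) 2 (obsLaw π Q) := by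
  refine memLp_obsLaw (measurable_augment hg) ?_ ?_
  · simp only [augment_seen]; exact hg2.const_smul _
  · simpa only [augment_unseen] using hg2

end weighting

section orthogonality

variable [MeasurableSpace Z] {π : ℝ} {k : ℕ} {Q : Vec k → Measure (FullDatum d Z)}
  {s : ObsDatum d Z → Vec k}

/-- The weight `1 - r/π` has mean zero given the covariates, whatever `Q` is, because `π` is fixed.
-/
theorem integral_augment (h₀ : 0 < π) (h₁ : π < 1) {Q : Measure (FullDatum d Z)}
    [SFinite Q] {g : Vec d × Z → ℝ} (hg : Measurable g)
    (hi : Integrable (fun u : FullDatum d Z => g u.1) Q) :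
    ∫ o, augment π g o ∂(obsLaw π Q) = 0 := by
  have hi : Integrable (augment π g) (obsLaw π Q) := by
    rw [integrable_obsLaw_iff h₀ h₁ (measurable_augment hg).aestronglyMeasurable]
    simp only [augment_seen, augment_unseen]
    exact ⟨hi.const_mul _, hi⟩
  rw [integral_obsLaw h₀ h₁ hi]
  simp only [augment_seen, augment_unseen]
  rw [integral_smul, smul_smul, ← add_smul]
  have : π * (1 - π⁻¹) + (1 - π) = 0 := by field_simp; ring
  rw [this, zero_smul]

/-- Scores of the observed data are uncorrelated with bounded augmentation terms. -/
theorem HasScore.integral_augment_mul_of_bounded (h₀ : 0 < π) (h₁ : π < 1)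
    (hs : HasScore (fun η => obsLaw π (Q η)) s) (hQ : ∀ᶠ η in 𝓝 0, IsProbabilityMeasure (Q η))
    {g : Vec d × Z → ℝ} (hg : Measurable g) {B : ℝ≥0} (hB : ∀ w, ‖g w‖₊ ≤ B) (v : Vec k) :
    ∫ o, augment π g o * ⟪s o, v⟫_ℝ ∂(obsLaw π (Q 0)) = 0 := by
  have hP : ∀ᶠ η in 𝓝 0, IsProbabilityMeasure (obsLaw π (Q η)) :=
    hQ.mono fun η _ => isProbabilityMeasure_obsLaw h₀ h₁ _
  refine hs.integral_mul_eq_zero hP (measurable_augment hg)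
    (C := (‖(1 : ℝ)‖₊ + ‖π⁻¹‖₊) ^ 2 * B ^ 2) ?_ ?_ v
  · filter_upwards [hP] with η hη
    calc ∫⁻ o, ‖augment π g o‖ₑ ^ 2 ∂(obsLaw π (Q η))
        ≤ ∫⁻ o, (((‖(1 : ℝ)‖₊ + ‖π⁻¹‖₊) ^ 2 * B ^ 2 : ℝ≥0) : ℝ≥0∞) ∂(obsLaw π (Q η)) := by
          refine lintegral_mono fun o => ?_
          rw [← mul_pow, ENNReal.coe_pow]
          gcongr
          rw [enorm_eq_nnnorm, ENNReal.coe_le_coe, augment, nnnorm_smul]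
          gcongr
          · refine (nnnorm_sub_le _ _).trans (add_le_add le_rfl ?_)
            split <;> simp
          · exact hB _
      _ = _ := by simp
  · have hz : ∀ᶠ η in 𝓝 0, ∫ o, augment π g o ∂(obsLaw π (Q η)) = 0 := by
      filter_upwards [hQ] with η hη
      refine integral_augment h₀ h₁ hg ?_
      exact Integrable.of_bound (hg.comp measurable_fst).aestronglyMeasurable B
        (ae_of_all _ fun u => hB u.1)
    filter_upwards [hz] with η hη
    rw [hη, hz.self_of_nhds]

/-- Scores of the observed data are uncorrelated with all square integrable augmentation terms. -/
theorem HasScore.integral_augment_mul (h₀ : 0 < π) (h₁ : π < 1)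
    (hs : HasScore (fun η => obsLaw π (Q η)) s) (hQ : ∀ᶠ η in 𝓝 0, IsProbabilityMeasure (Q η))
    {g : Vec d × Z → ℝ} (hg : Measurable g)
    (hg2 : MemLp (fun u : FullDatum d Z => g u.1) 2 (Q 0)) (v : Vec k) :
    ∫ o, augment π g o * ⟪s o, v⟫_ℝ ∂(obsLaw π (Q 0)) = 0 := by
  have hQ0 := hQ.self_of_nhds
  have htm := measurable_truncate hg
  have htb : ∀ n w, ‖truncate g n w‖₊ ≤ (n : ℝ≥0) := by
    intro n w
    rw [← NNReal.coe_le_coe]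
    exact abs_truncate_le g n w
  -- An unbounded `g` need not have bounded second moments along the family, so the bounded case is
  -- applied to truncations, dominated by the product for `g` itself.
  have hlim : Tendsto
      (fun n : ℕ => ∫ o, augment π (truncate g n) o * ⟪s o, v⟫_ℝ ∂(obsLaw π (Q 0))) atTop
      (𝓝 (∫ o, augment π g o * ⟪s o, v⟫_ℝ ∂(obsLaw π (Q 0)))) := by
    have hs2 : MemLp (fun o => ⟪s o, v⟫_ℝ) 2 (obsLaw π (Q 0)) := hs.1.inner_const v
    refine tendsto_integral_of_dominated_convergence
      (fun o => |augment π g o| * |⟪s o, v⟫_ℝ|) ?_ ?_ ?_ ?_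
    · exact fun n => (measurable_augment (htm n)).aestronglyMeasurable.mul hs2.1
    · exact integrable_abs_mul_of_memLp (memLp_augment hg hg2) hs2
    · intro n
      filter_upwards with o
      rw [norm_mul, Real.norm_eq_abs, Real.norm_eq_abs, augment, augment, smul_eq_mul,
        smul_eq_mul, abs_mul, abs_mul]
      exact mul_le_mul_of_nonneg_right (mul_le_mul_of_nonneg_left (abs_truncate_le_abs g n _)
        (abs_nonneg _)) (abs_nonneg _)
    · filter_upwards with o
      refine tendsto_const_nhds.congr' ?_
      filter_upwards [eventually_truncate_eq g o.2.1] with n hn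
      rw [augment, augment, hn]
  refine tendsto_nhds_unique hlim (tendsto_const_nhds.congr fun n => ?_)
  exact (hs.integral_augment_mul_of_bounded h₀ h₁ hQ (htm n) (htb n) v).symm

/-- Vector valued version of `HasScore.integral_augment_mul`. -/
theorem HasScore.integral_smul_augment (h₀ : 0 < π) (h₁ : π < 1)
    (hs : HasScore (fun η => obsLaw π (Q η)) s) (hQ : ∀ᶠ η in 𝓝 0, IsProbabilityMeasure (Q η))
    {g : Vec d × Z → Vec q} (hg : Measurable g)
    (hg2 : MemLp (fun u : FullDatum d Z => g u.1) 2 (Q 0)) (v : Vec k) :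
    ∫ o, ⟪s o, v⟫_ℝ • augment π g o ∂(obsLaw π (Q 0)) = 0 := by
  have hQ0 := hQ.self_of_nhds
  have hP0 := isProbabilityMeasure_obsLaw h₀ h₁ (Q 0)
  have hs2 : MemLp (fun o => ⟪s o, v⟫_ℝ) 2 (obsLaw π (Q 0)) := hs.1.inner_const v
  have hi : Integrable (fun o => ⟪s o, v⟫_ℝ • augment π g o) (obsLaw π (Q 0)) :=
    ((memLp_augment hg hg2).smul hs2).integrable le_rfl
  ext j
  have h1 : ∫ o, (⟪s o, v⟫_ℝ • augment π g o) j ∂(obsLaw π (Q 0)) =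
      (∫ o, ⟪s o, v⟫_ℝ • augment π g o ∂(obsLaw π (Q 0))) j :=
    (EuclideanSpace.proj (𝕜 := ℝ) j).integral_comp_comm hi
  rw [← h1]
  have h2 := hs.integral_augment_mul h₀ h₁ hQ (g := fun w => g w j)
    ((EuclideanSpace.proj (𝕜 := ℝ) j).measurable.comp hg)
    ((EuclideanSpace.proj (𝕜 := ℝ) j).comp_memLp' hg2) v
  simp only [PiLp.zero_apply]
  rw [← h2]
  congr 1 with o
  simp [augment]
  ring

end orthogonality

end MissingLabel

/-! ### Differentiability of the parameter along regular submodels -/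

namespace MissingLabel

variable {d q : ℕ} {Z : Type*} [MeasurableSpace Z]

theorem measurable_estFun {ψ : ℝ → Vec d → Vec q → Vec q} {θ : Vec q}
    (h : Measurable fun p : ℝ × Vec d => ψ p.1 p.2 θ) :
    Measurable (estFun ψ θ : FullDatum d Z → Vec q) :=
  h.comp (f := fun u : FullDatum d Z => (u.2, u.1.1)) (by fun_prop)

theorem InModel.param_spec {ψ : ℝ → Vec d → Vec q → Vec q} {Θ : Set (Vec q)}
    {Q : Measure (FullDatum d Z)} (h : InModel ψ Θ Q) :
    param ψ Θ Q ∈ Θ ∧ ∫ u, estFun ψ (param ψ Θ Q) u ∂Q = 0 :=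
  Classical.epsilon_spec (p := fun θ => θ ∈ Θ ∧ ∫ u, estFun ψ θ u ∂Q = 0) h.2.2.exists

theorem condMean_eq_fiberMean (ψ : ℝ → Vec d → Vec q → Vec q) (θ : Vec q)
    (Q : Measure (FullDatum d Z)) [IsFiniteMeasure Q] :
    condMean ψ θ Q = fiberMean Q (estFun ψ θ) := rfl

/-- Regrouping `(r/π)(ψ - g) + g = (r/π) ψ + (1 - r/π) g` separates the part that produces the
derivative from the part orthogonal to all scores. -/
theorem eifFormula_eq (ψ : ℝ → Vec d → Vec q → Vec q) (π : ℝ) (A : Matrix (Fin q) (Fin q) ℝ)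
    (θ : Vec q) (Q : Measure (FullDatum d Z)) [IsFiniteMeasure Q] (o : ObsDatum d Z) :
    eifFormula ψ π A θ Q o = Matrix.toEuclideanCLM (𝕜 := ℝ) A⁻¹
      (ipw π (estFun ψ θ) o + augment π (fiberMean Q (estFun ψ θ)) o) := by
  obtain ⟨r, ⟨x, z⟩, y⟩ := o
  rw [← condMean_eq_fiberMean]
  have e : ((if r then (1 : ℝ) else 0) / π) = if r then π⁻¹ else 0 := by
    split <;> simp
  simp only [eifFormula, ipw, augment, estFun, e, map_add, map_smul, map_sub, smul_sub, sub_smul,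
    one_smul]
  abel

section gradient

variable {π : ℝ} {k : ℕ} {Q : Vec k → Measure (FullDatum d Z)} {s : ObsDatum d Z → Vec k}

theorem integrable_inner_smul {Ω : Type*} [MeasurableSpace Ω] {P : Measure Ω} {s : Ω → Vec k}
    {f : Ω → Vec q} (hs : MemLp s 2 P) (hf : MemLp f 2 P) (v : Vec k) :
    Integrable (fun o => ⟪s o, v⟫_ℝ • f o) P := by
  have hs2 : MemLp (fun o => ⟪s o, v⟫_ℝ) 2 P := hs.inner_const v
  exact memLp_one_iff_integrable.1 (hf.smul hs2)

/-- The derivative of the mean of `f` in direction `η`, by the score `s`. -/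
noncomputable def scoreMean {Ω : Type*} [MeasurableSpace Ω] (P : Measure Ω) (s : Ω → Vec k)
    (f : Ω → Vec q) (hs : MemLp s 2 P) (hf : MemLp f 2 P) : Vec k →L[ℝ] Vec q :=
  LinearMap.toContinuousLinearMap
    { toFun := fun v => ∫ o, ⟪s o, v⟫_ℝ • f o ∂P
      map_add' := fun v w => by
        simp only [inner_add_right, add_smul]
        refine integral_add ?_ ?_
        · exact integrable_inner_smul hs hf v
        · exact integrable_inner_smul hs hf w
      map_smul' := fun c v => by
        simp only [inner_smul_right, mul_smul, RingHom.id_apply]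
        exact integral_smul _ _ }

theorem scoreMean_apply {Ω : Type*} [MeasurableSpace Ω] {P : Measure Ω} {s : Ω → Vec k}
    {f : Ω → Vec q} (hs : MemLp s 2 P) (hf : MemLp f 2 P) (v : Vec k) :
    scoreMean P s f hs hf v = ∫ o, ⟪s o, v⟫_ℝ • f o ∂P := rfl

/-- Along a regular submodel, the means of `ψ(Y, X; θ)` have first order expansions, uniformly in
`θ ∈ Θ`. -/
theorem HasScore.estFun_expansion {ψ : ℝ → Vec d → Vec q → Vec q} {Θ : Set (Vec q)}
    (h₀ : 0 < π) (h₁ : π < 1)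
    (hmeas : ∀ θ ∈ Θ, Measurable fun p : ℝ × Vec d => ψ p.1 p.2 θ)
    (hs : HasScore (fun η => obsLaw π (Q η)) s)
    (hQ : ∀ᶠ η in 𝓝 0, IsProbabilityMeasure (Q η)) {C : ℝ≥0}
    (hC : ∀ᶠ η in 𝓝 0, ∀ θ ∈ Θ, ∫⁻ u, ‖estFun ψ θ u‖ₑ ^ 2 ∂(Q η) ≤ C) {ε : ℝ} (hε : 0 < ε) :
    ∀ᶠ η in 𝓝 0, ∀ θ ∈ Θ, ‖∫ u, estFun ψ θ u ∂(Q η) - ∫ u, estFun ψ θ u ∂(Q 0)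
      - ∫ o, ⟪s o, η⟫_ℝ • ipw π (estFun ψ θ) o ∂(obsLaw π (Q 0))‖ ≤ ε * ‖η‖ := by
  have hQ0 := hQ.self_of_nhds
  have hP : ∀ᶠ η in 𝓝 0, IsProbabilityMeasure (obsLaw π (Q η)) :=
    hQ.mono fun η _ => isProbabilityMeasure_obsLaw h₀ h₁ _
  have hm : ∀ θ ∈ Θ, Measurable (estFun ψ θ : FullDatum d Z → Vec q) :=
    fun θ hθ => measurable_estFun (hmeas θ hθ)
  have main := hs.expansion_vec hP (ι := Θ) (f := fun θ => ipw π (estFun ψ θ))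
    (fun θ => measurable_ipw (hm θ θ.2)) (C := π⁻¹.toNNReal * C) (by
      filter_upwards [hQ, hC] with η hη hCη θ
      rw [lintegral_ipw_sq h₀ (hm θ θ.2), ENNReal.coe_mul]
      exact mul_le_mul_right (hCη θ θ.2) _) hε
  have hi : ∀ᶠ η in 𝓝 0, ∀ θ ∈ Θ, ∫ o, ipw π (estFun ψ θ) o ∂(obsLaw π (Q η)) =
      ∫ u, estFun ψ θ u ∂(Q η) := by
    filter_upwards [hQ, hC] with η hη hCη θ hθ
    exact integral_ipw h₀ h₁ (hm θ hθ)
      ((memLp_two_of_lintegral_le (hm θ hθ).aestronglyMeasurable (hCη θ hθ)).integrable one_le_two)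
  filter_upwards [main, hi] with η h1 h2 θ hθ
  rw [← h2 θ hθ, ← hi.self_of_nhds θ hθ]
  exact h1 ⟨θ, hθ⟩

/-- The expansion, uniform in `θ`, may be evaluated at the root for `Q η`; it shows that the mean
under `Q 0` is `O(‖η‖)` there. Separation of the root then forces convergence. -/
theorem tendsto_param {ψ : ℝ → Vec d → Vec q → Vec q} {Θ : Set (Vec q)} {θ₀ : Vec q}
    (h₀ : 0 < π) (h₁ : π < 1) (hΘ : IsCompact Θ)
    (hroot : ∀ θ ∈ Θ, ∫ u, estFun ψ θ u ∂(Q 0) = 0 ↔ θ = θ₀)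
    (hmeas : ∀ θ ∈ Θ, Measurable fun p : ℝ × Vec d => ψ p.1 p.2 θ)
    (hcont : ContinuousOn (fun θ => ∫ u, estFun ψ θ u ∂(Q 0)) Θ)
    (hs : HasScore (fun η => obsLaw π (Q η)) s)
    (hmem : ∀ᶠ η in 𝓝 0, InModel ψ Θ (Q η)) {C : ℝ≥0}
    (hC : ∀ᶠ η in 𝓝 0, ∀ θ ∈ Θ, ∫⁻ u, ‖estFun ψ θ u‖ₑ ^ 2 ∂(Q η) ≤ C) :
    Tendsto (fun η => param ψ Θ (Q η)) (𝓝 0) (𝓝 θ₀) := by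
  have hQ : ∀ᶠ η in 𝓝 0, IsProbabilityMeasure (Q η) := hmem.mono fun η h => h.1
  have hQ0 := hQ.self_of_nhds
  have hm : ∀ θ ∈ Θ, Measurable (estFun ψ θ : FullDatum d Z → Vec q) :=
    fun θ hθ => measurable_estFun (hmeas θ hθ)
  have hexp := hs.estFun_expansion h₀ h₁ hmeas hQ hC one_pos
  have hL2 : ∀ θ ∈ Θ, MemLp (ipw π (estFun ψ θ)) 2 (obsLaw π (Q 0)) := fun θ hθ =>
    memLp_ipw (hm θ hθ)
      (memLp_two_of_lintegral_le (hm θ hθ).aestronglyMeasurable (hC.self_of_nhds θ hθ))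
  have hB : ∀ θ ∈ Θ, ∫ o, ‖ipw π (estFun ψ θ) o‖ ^ 2 ∂(obsLaw π (Q 0)) ≤
      ((π⁻¹.toNNReal * C : ℝ≥0) : ℝ) := fun θ hθ => by
    refine integral_sq_norm_le_of_lintegral_le (hL2 θ hθ).1 ?_
    rw [lintegral_ipw_sq h₀ (hm θ hθ), ENNReal.coe_mul]
    exact mul_le_mul_right (hC.self_of_nhds θ hθ) _
  set B := ((π⁻¹.toNNReal * C : ℝ≥0) : ℝ)
  set N := √(∫ o, ‖s o‖ ^ 2 ∂(obsLaw π (Q 0)))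
  have hlim : Tendsto (fun η : Vec k => (1 + N * √B) * ‖η‖) (𝓝 0) (𝓝 0) := by
    have : Continuous fun η : Vec k => (1 + N * √B) * ‖η‖ := by fun_prop
    simpa using this.tendsto 0
  intro U hU
  obtain ⟨δ, hδ, hδU⟩ := exists_pos_le_norm_of_root hΘ hcont hroot hU
  change ∀ᶠ η in 𝓝 0, param ψ Θ (Q η) ∈ U
  filter_upwards [hexp, hmem, (tendsto_order.1 hlim).2 δ hδ] with η h1 h2 h3
  obtain ⟨hθ, h0⟩ := h2.param_spec
  by_contra hnot
  have h4 := hδU _ hθ hnot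
  have h5 := h1 _ hθ
  have h6 := norm_integral_inner_smul_le hs.1 (hL2 _ hθ) η
  have h7 : √(∫ o, ‖ipw π (estFun ψ (param ψ Θ (Q η))) o‖ ^ 2 ∂(obsLaw π (Q 0))) ≤ √B :=
    Real.sqrt_le_sqrt (hB _ hθ)
  rw [h0, zero_sub, ← neg_add', norm_neg] at h5
  have h8 := norm_le_add_norm_add (∫ u, estFun ψ (param ψ Θ (Q η)) u ∂(Q 0))
    (∫ o, ⟪s o, η⟫_ℝ • ipw π (estFun ψ (param ψ Θ (Q η))) o ∂(obsLaw π (Q 0)))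
  have h9 : N * √(∫ o, ‖ipw π (estFun ψ (param ψ Θ (Q η))) o‖ ^ 2 ∂(obsLaw π (Q 0))) * ‖η‖ ≤
      N * √B * ‖η‖ := by gcongr
  linarith

/-- Along a regular submodel, the parameter is differentiable. -/
theorem hasFDerivAt_param {ψ : ℝ → Vec d → Vec q → Vec q} {Θ : Set (Vec q)} {θ₀ : Vec q}
    {A : Matrix (Fin q) (Fin q) ℝ}
    (h₀ : 0 < π) (h₁ : π < 1) (hΘ : IsCompact Θ) (hθ₀ : θ₀ ∈ Θ)
    (hroot : ∀ θ ∈ Θ, ∫ u, estFun ψ θ u ∂(Q 0) = 0 ↔ θ = θ₀)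
    (hmeas : ∀ θ ∈ Θ, Measurable fun p : ℝ × Vec d => ψ p.1 p.2 θ)
    (hcont : ContinuousOn (fun θ => ∫ u, estFun ψ θ u ∂(Q 0)) Θ)
    (hcont₂ : Tendsto (fun θ => ∫⁻ u, ‖estFun ψ θ u - estFun ψ θ₀ u‖ₑ ^ 2 ∂(Q 0))
      (𝓝 θ₀) (𝓝 0))
    (hA : IsUnit A.det)
    (hderiv : HasFDerivAt (fun θ => ∫ u, estFun ψ θ u ∂(Q 0))
      (-Matrix.toEuclideanCLM (𝕜 := ℝ) A) θ₀)
    (hs : HasScore (fun η => obsLaw π (Q η)) s)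
    (hmem : ∀ᶠ η in 𝓝 0, InModel ψ Θ (Q η)) {C : ℝ≥0}
    (hC : ∀ᶠ η in 𝓝 0, ∀ θ ∈ Θ, ∫⁻ u, ‖estFun ψ θ u‖ₑ ^ 2 ∂(Q η) ≤ C)
    (hL : MemLp (ipw π (estFun ψ θ₀)) 2 (obsLaw π (Q 0))) :
    HasFDerivAt (fun η => param ψ Θ (Q η)) ((Matrix.toEuclideanCLM (𝕜 := ℝ) A⁻¹).comp
      (scoreMean (obsLaw π (Q 0)) s (ipw π (estFun ψ θ₀)) hs.1 hL)) 0 := by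
  have hQ : ∀ᶠ η in 𝓝 0, IsProbabilityMeasure (Q η) := hmem.mono fun η h => h.1
  have hQ0 := hQ.self_of_nhds
  have hP0 := isProbabilityMeasure_obsLaw h₀ h₁ (Q 0)
  have hm : ∀ θ ∈ Θ, Measurable (estFun ψ θ : FullDatum d Z → Vec q) :=
    fun θ hθ => measurable_estFun (hmeas θ hθ)
  have htend := tendsto_param h₀ h₁ hΘ hroot hmeas hcont hs hmem hC
  have hL2 : ∀ θ ∈ Θ, MemLp (ipw π (estFun ψ θ)) 2 (obsLaw π (Q 0)) := fun θ hθ =>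
    memLp_ipw (hm θ hθ)
      (memLp_two_of_lintegral_le (hm θ hθ).aestronglyMeasurable (hC.self_of_nhds θ hθ))
  refine hasFDerivAt_of_root (m := fun θ => ∫ u, estFun ψ θ u ∂(Q 0))
    (fun x => toEuclideanCLM_inv_apply hA x) ?_ htend hderiv ((hroot θ₀ hθ₀).2 rfl) ?_
  · obtain ⟨h1, h2⟩ := hmem.self_of_nhds.param_spec
    exact (hroot _ h1).1 h2
  -- The uniform expansion costs `ε / 2` and leaves a score mean with `ψ` at the moving root.
  -- Replacing that root by `θ₀` costs at most `N c ≤ ε / 2`, by Cauchy-Schwarz and mean square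
  -- continuity.
  refine Asymptotics.IsLittleO.of_bound fun ε hε => ?_
  set N := √(∫ o, ‖s o‖ ^ 2 ∂(obsLaw π (Q 0))) with hN
  have hN0 : 0 ≤ N := Real.sqrt_nonneg _
  set c := ε / (2 * (N + 1)) with hc
  have hc0 : 0 < c := by positivity
  have hNc : N * c ≤ ε / 2 := by
    rw [hc, ← mul_div_assoc, div_le_iff₀ (by positivity)]
    nlinarith
  have hclose : ∀ᶠ η in 𝓝 (0 : Vec k),
      ENNReal.ofReal π⁻¹ * ∫⁻ u, ‖estFun ψ (param ψ Θ (Q η)) u - estFun ψ θ₀ u‖ₑ ^ 2 ∂(Q 0) <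
        ENNReal.ofReal (c ^ 2) := by
    have h1 := ENNReal.Tendsto.const_mul (a := ENNReal.ofReal π⁻¹) (hcont₂.comp htend)
      (Or.inr ENNReal.ofReal_ne_top)
    rw [mul_zero] at h1
    exact (tendsto_order.1 h1).2 _ (ENNReal.ofReal_pos.2 (by positivity))
  filter_upwards [hs.estFun_expansion h₀ h₁ hmeas hQ hC (half_pos hε), hmem, hclose]
    with η h1 h2 h3
  obtain ⟨hθ, h0⟩ := h2.param_spec
  have h4 := h1 _ hθ
  rw [h0, zero_sub, ← neg_add', norm_neg] at h4
  set θ := param ψ Θ (Q η)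
  have hd : MemLp (ipw π (fun u => estFun ψ θ u - estFun ψ θ₀ u)) 2 (obsLaw π (Q 0)) := by
    exact ((hL2 θ hθ).sub hL).ae_eq (ae_of_all _ fun o => by simp [ipw, smul_sub])
  have h5 := norm_integral_inner_smul_le hs.1 hd η
  have h6 : √(∫ o, ‖ipw π (fun u => estFun ψ θ u - estFun ψ θ₀ u) o‖ ^ 2 ∂(obsLaw π (Q 0)))
      ≤ c := by
    refine Real.sqrt_le_iff.2 ⟨hc0.le, ?_⟩
    refine (integral_sq_norm_le_of_lintegral_le (C := (c ^ 2).toNNReal) hd.1 ?_).trans_eq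
      (Real.coe_toNNReal _ (by positivity))
    exact (lintegral_ipw_sq h₀ (f := fun u => estFun ψ θ u - estFun ψ θ₀ u)
      ((hm θ hθ).sub (hm θ₀ hθ₀))).trans_le h3.le
  have e : ∫ u, estFun ψ θ u ∂(Q 0) + scoreMean (obsLaw π (Q 0)) s (ipw π (estFun ψ θ₀)) hs.1 hL η
      = (∫ u, estFun ψ θ u ∂(Q 0) + ∫ o, ⟪s o, η⟫_ℝ • ipw π (estFun ψ θ) o ∂(obsLaw π (Q 0)))
        - ∫ o, ⟪s o, η⟫_ℝ • ipw π (fun u => estFun ψ θ u - estFun ψ θ₀ u) o ∂(obsLaw π (Q 0)) := by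
    have i1 := integrable_inner_smul hs.1 (hL2 θ hθ) η
    have i2 := integrable_inner_smul hs.1 hL η
    have : ∫ o, ⟪s o, η⟫_ℝ • ipw π (fun u => estFun ψ θ u - estFun ψ θ₀ u) o ∂(obsLaw π (Q 0)) =
        ∫ o, ⟪s o, η⟫_ℝ • ipw π (estFun ψ θ) o ∂(obsLaw π (Q 0))
        - ∫ o, ⟪s o, η⟫_ℝ • ipw π (estFun ψ θ₀) o ∂(obsLaw π (Q 0)) := by
      rw [← integral_sub i1 i2]
      congr 1 with o
      simp [ipw, smul_sub]
    rw [this, scoreMean_apply]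
    abel
  rw [e]
  have h7 : N * √(∫ o, ‖ipw π (fun u => estFun ψ θ u - estFun ψ θ₀ u) o‖ ^ 2 ∂(obsLaw π (Q 0)))
      * ‖η‖ ≤ N * c * ‖η‖ := by gcongr
  have h8 : N * c * ‖η‖ ≤ ε / 2 * ‖η‖ := by gcongr
  refine (norm_sub_le _ _).trans ?_
  linarith

end gradient

end MissingLabel

/-! ### Persistence of a unique root, and scores of bounded tilts -/

namespace MissingLabel

/-- A unique nondegenerate zero in a compact set persists, and stays unique, under small
perturbations that are bounded and Lipschitz near the zero. -/
theorem eventually_existsUnique_root {F : Type*} [NormedAddCommGroup F] [NormedSpace ℝ F]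
    [CompleteSpace F] {m p : F → F} {Θ : Set F} {θ₀ : F} {T : F ≃L[ℝ] F} {L K : ℝ}
    (hΘ : IsCompact Θ) (hθ₀ : θ₀ ∈ interior Θ) (hcont : ContinuousOn m Θ)
    (hroot : ∀ θ ∈ Θ, m θ = 0 ↔ θ = θ₀) (hderiv : HasStrictFDerivAt m (T : F →L[ℝ] F) θ₀)
    (hp : ∀ᶠ x : F × F in 𝓝 (θ₀, θ₀), ‖p x.1 - p x.2‖ ≤ L * ‖x.1 - x.2‖)
    (hK : ∀ θ ∈ Θ, ‖p θ‖ ≤ K) :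
    ∀ᶠ t : ℝ in 𝓝 0, ∃! θ, θ ∈ Θ ∧ m θ + t • p θ = 0 := by
  rcases subsingleton_or_nontrivial F with hF | hF
  · exact Eventually.of_forall fun t =>
      ⟨θ₀, ⟨interior_subset hθ₀, Subsingleton.elim _ _⟩, fun _ _ => Subsingleton.elim _ _⟩
  have hT : 0 < ‖(T.symm : F →L[ℝ] F)‖₊ := by
    rcases T.subsingleton_or_nnnorm_symm_pos with h | h
    · exact absurd h (not_subsingleton F)
    · exact h
  -- A map approximating `T` with constant below `N = ‖T⁻¹‖⁻¹` on a ball is injective there and its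
  -- image covers a ball. The constant used is `N / 2`, shared equally between `m` and `t • p`.
  set N : ℝ≥0 := ‖(T.symm : F →L[ℝ] F)‖₊⁻¹ with hN
  have hN0 : 0 < N := inv_pos.2 hT
  have hN0' : (0 : ℝ) < N := hN0
  obtain ⟨s, hs, hms⟩ := hderiv.approximates_deriv_on_nhds (c := N / 4) (Or.inr (by positivity))
  rw [nhds_prod_eq] at hp
  obtain ⟨V, hV, hpV⟩ := hp.exists_mem
  obtain ⟨V₁, hV₁, hV₁V⟩ := mem_prod_same_iff.1 hV
  obtain ⟨ε, hε, hball⟩ := Metric.nhds_basis_closedBall.mem_iff.1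
    (inter_mem (inter_mem hs hV₁) (mem_interior_iff_mem_nhds.1 hθ₀))
  obtain ⟨δ, hδ, hδU⟩ := exists_pos_le_norm_of_root hΘ hcont hroot
    (Metric.closedBall_mem_nhds θ₀ hε)
  have ev : ∀ (a b : ℝ), 0 < b → ∀ᶠ t : ℝ in 𝓝 0, |t| * a < b := by
    intro a b hb
    have : Continuous fun t : ℝ => |t| * a := by fun_prop
    refine (tendsto_order.1 (this.tendsto 0)).2 b ?_
    simpa using hb
  -- In turn: `t • p` has Lipschitz constant at most `N / 4` near `θ₀`; it is too small to create a
  -- root outside the ball; and the value at `θ₀` is close enough to `0` for the image of the ball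
  -- to contain `0`.
  filter_upwards [ev L (N / 4) (by positivity), ev K δ hδ, ev K (N / 2 * ε) (by positivity)]
    with t ht1 ht2 ht3
  have hΘball : ∀ θ ∈ Metric.closedBall θ₀ ε, θ ∈ Θ := fun θ hθ => (hball hθ).2
  have happ : ApproximatesLinearOn (fun θ => m θ + t • p θ) (T : F →L[ℝ] F)
      (Metric.closedBall θ₀ ε) (N / 2) := by
    intro x hx y hy
    have h1 := hms x (hball hx).1.1 y (hball hy).1.1
    have h2 := hpV (x, y) (hV₁V ⟨(hball hx).1.2, (hball hy).1.2⟩)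
    have e : m x + t • p x - (m y + t • p y) - T (x - y) =
        (m x - m y - T (x - y)) + t • (p x - p y) := by
      rw [smul_sub]; abel
    calc ‖m x + t • p x - (m y + t • p y) - T (x - y)‖
        ≤ ‖m x - m y - T (x - y)‖ + |t| * ‖p x - p y‖ := by
          rw [e]
          refine (norm_add_le _ _).trans ?_
          rw [norm_smul, Real.norm_eq_abs]
      _ ≤ (N / 4 : ℝ≥0) * ‖x - y‖ + |t| * (L * ‖x - y‖) := by gcongr; exact h1
      _ ≤ (N / 4 : ℝ≥0) * ‖x - y‖ + N / 4 * ‖x - y‖ := by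
          rw [← mul_assoc]; gcongr
      _ = (N / 2 : ℝ≥0) * ‖x - y‖ := by push_cast; ring
  have hlt : N / 2 < N := NNReal.half_lt_self hN0.ne'
  have hinj := happ.injOn (Or.inr hlt)
  have hsurj := happ.surjOn_closedBall_of_nonlinearRightInverse T.toNonlinearRightInverse hε.le
    subset_rfl
  have hθ₀Θ := interior_subset hθ₀
  have h0 : (0 : F) ∈ Metric.closedBall (m θ₀ + t • p θ₀)
      (((T.toNonlinearRightInverse.nnnorm : ℝ)⁻¹ - (N / 2 : ℝ≥0)) * ε) := by
    have e : (T.toNonlinearRightInverse.nnnorm : ℝ)⁻¹ = N := by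
      rw [hN, NNReal.coe_inv]; rfl
    rw [e, Metric.mem_closedBall, dist_eq_norm, (hroot θ₀ hθ₀Θ).2 rfl, zero_add, zero_sub,
      norm_neg, norm_smul, Real.norm_eq_abs]
    calc |t| * ‖p θ₀‖ ≤ |t| * K := by gcongr; exact hK _ hθ₀Θ
      _ ≤ N / 2 * ε := ht3.le
      _ = _ := by push_cast; ring
  obtain ⟨θ, hθ, hθ0⟩ := hsurj h0
  refine ⟨θ, ⟨hΘball θ hθ, hθ0⟩, fun θ' hθ' => ?_⟩
  by_cases hmem : θ' ∈ Metric.closedBall θ₀ ε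
  · exact hinj hmem hθ (hθ'.2.trans hθ0.symm)
  · have h1 := hδU θ' hθ'.1 hmem
    rw [eq_neg_of_add_eq_zero_left hθ'.2, norm_neg, norm_smul, Real.norm_eq_abs] at h1
    have h2 : |t| * ‖p θ'‖ ≤ |t| * K := by gcongr; exact hK _ hθ'.1
    linarith

/-- The error is exactly `-(√(1 + x) - 1)² / 2`, and `|√(1 + x) - 1| ≤ |x|`. It is the pointwise
remainder in the quadratic mean expansion of a tilt. -/
theorem abs_sqrt_one_add_sub_le {x : ℝ} (hx : -1 ≤ x) : |√(1 + x) - 1 - 1 / 2 * x| ≤ x ^ 2 := by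
  have h0 := Real.sqrt_nonneg (1 + x)
  have h1 : √(1 + x) ^ 2 = 1 + x := Real.sq_sqrt (by linarith)
  have e : √(1 + x) - 1 - 1 / 2 * x = -((√(1 + x) - 1) ^ 2 / 2) := by nlinarith
  have e2 : x = (√(1 + x) - 1) * (√(1 + x) + 1) := by nlinarith
  have h2 : (√(1 + x) - 1) ^ 2 ≤ x ^ 2 := by
    conv_rhs => rw [e2, mul_pow]
    have : 1 ≤ (√(1 + x) + 1) ^ 2 := by nlinarith
    nlinarith [sq_nonneg (√(1 + x) - 1)]
  rw [e, abs_neg, abs_of_nonneg (by positivity)]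
  nlinarith [sq_nonneg x]

section tilt

theorem abs_mul_le_of_bounded {Ω : Type*} {h : Ω → ℝ} {B t : ℝ} (hB : ∀ o, |h o| ≤ B)
    (ht : |t| * B ≤ 1) (o : Ω) : |t * h o| ≤ 1 := by
  rw [abs_mul]
  exact (mul_le_mul_of_nonneg_left (hB o) (abs_nonneg t)).trans ht

theorem one_add_nonneg_of_bounded {Ω : Type*} {h : Ω → ℝ} {B t : ℝ} (hB : ∀ o, |h o| ≤ B)
    (ht : |t| * B ≤ 1) (o : Ω) : 0 ≤ 1 + t * h o := by
  linarith [neg_le_of_abs_le (abs_mul_le_of_bounded hB ht o)]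

variable {Ω : Type*} [MeasurableSpace Ω]

/-- The measure with density `1 + t h` with respect to `P`. -/
noncomputable def tilt (P : Measure Ω) (h : Ω → ℝ) (t : ℝ) : Measure Ω :=
  P.withDensity fun o => ENNReal.ofReal (1 + t * h o)

variable {P : Measure Ω} {h : Ω → ℝ} {B t : ℝ}

theorem tilt_zero : tilt P h 0 = P := by
  simp only [tilt, zero_mul, add_zero, ENNReal.ofReal_one]
  exact withDensity_one

theorem tilt_le (hB : ∀ o, |h o| ≤ B) (ht : |t| * B ≤ 1) :
    tilt P h t ≤ (2 : ℝ≥0∞) • P := by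
  rw [← withDensity_const]
  refine withDensity_mono (ae_of_all _ fun o => ?_)
  refine (ENNReal.ofReal_le_ofReal (q := 2) ?_).trans (by simp)
  linarith [le_of_abs_le (abs_mul_le_of_bounded hB ht o)]

theorem integral_tilt {E : Type*} [NormedAddCommGroup E] [NormedSpace ℝ E]
    (hm : Measurable h) (hB : ∀ o, |h o| ≤ B) (ht : |t| * B ≤ 1) {f : Ω → E}
    (hf : Integrable f P) :
    ∫ o, f o ∂(tilt P h t) = ∫ o, f o ∂P + t • ∫ o, h o • f o ∂P := by
  have hi : Integrable (fun o => h o • f o) P := by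
    exact hf.bdd_smul B hm.aestronglyMeasurable (ae_of_all _ hB)
  rw [tilt, integral_withDensity_eq_integral_toReal_smul (by fun_prop) (by simp),
    ← integral_smul, ← integral_add hf (by exact hi.smul t)]
  congr 1 with o
  rw [ENNReal.toReal_ofReal (one_add_nonneg_of_bounded hB ht o), add_smul, one_smul, mul_smul]

theorem isProbabilityMeasure_tilt [IsProbabilityMeasure P] (hm : Measurable h)
    (hB : ∀ o, |h o| ≤ B) (h0 : ∫ o, h o ∂P = 0) (ht : |t| * B ≤ 1) :
    IsProbabilityMeasure (tilt P h t) := by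
  constructor
  have hi : Integrable h P := Integrable.of_bound hm.aestronglyMeasurable B (ae_of_all _ hB)
  rw [tilt, withDensity_apply _ MeasurableSet.univ, Measure.restrict_univ,
    ← ofReal_integral_eq_lintegral_ofReal (by exact (integrable_const 1).add (hi.const_mul t))
    (ae_of_all _ (one_add_nonneg_of_bounded hB ht)),
    integral_add (integrable_const 1) (hi.const_mul t), integral_const_mul, h0]
  simp

/-- A family which near `0` is a tilt by a bounded function `S` has score `S`. -/
theorem hasScore_of_eventually_eq_tilt [IsProbabilityMeasure P] {S : Ω → ℝ} (hm : Measurable S)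
    (hB : ∀ o, |S o| ≤ B) {R : Vec 1 → Measure Ω} (hR : ∀ᶠ η in 𝓝 0, R η = tilt P S (η 0)) :
    HasScore R (fun o => !₂[S o]) := by
  have hR0 : R 0 = P := by rw [hR.self_of_nhds]; exact tilt_zero
  have hmeas : Measurable fun o => (!₂[S o] : Vec 1) := by
    refine (WithLp.measurable_toLp 2 _).comp (measurable_pi_lambda _ fun i => ?_)
    fin_cases i
    exact hm
  refine ⟨?_, P, inferInstance, ?_, ?_⟩
  · rw [hR0]
    refine MemLp.of_bound hmeas.aestronglyMeasurable B (ae_of_all _ fun o => ?_)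
    simpa [EuclideanSpace.norm_eq, Real.sqrt_sq_eq_abs] using hB o
  · filter_upwards [hR] with η hη
    rw [hη]
    exact withDensity_absolutelyContinuous _ _
  · have hlim : Tendsto (fun η : Vec 1 => |η 0| * B) (𝓝 0) (𝓝 0) := by
      have : Continuous fun η : Vec 1 => |η 0| * B := by fun_prop
      simpa using this.tendsto 0
    have hsmall : ∀ᶠ η : Vec 1 in 𝓝 0, |η 0| * B ≤ 1 :=
      ((tendsto_order.1 hlim).2 1 one_pos).mono fun _ h => h.le
    refine Asymptotics.IsLittleO.of_bound fun c hc => ?_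
    -- The squared remainder is at most `(‖η‖ B)⁴`, one factor `‖η‖²` more than needed.
    have hlim2 : Tendsto (fun η : Vec 1 => B ^ 4 * ‖η‖ ^ 2) (𝓝 0) (𝓝 0) := by
      have : Continuous fun η : Vec 1 => B ^ 4 * ‖η‖ ^ 2 := by fun_prop
      simpa using this.tendsto 0
    filter_upwards [hR, hsmall, (tendsto_order.1 hlim2).2 c hc] with η hη ht hc'
    have hd : ∀ {τ : ℝ}, (tilt P S τ).rnDeriv P =ᵐ[P] fun o => ENNReal.ofReal (1 + τ * S o) :=
      Measure.rnDeriv_withDensity P (by fun_prop)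
    have hη0 : |η 0| ≤ ‖η‖ := PiLp.norm_apply_le η 0
    have hb : ∀ᵐ o ∂P, ‖(√((R η).rnDeriv P o).toReal - √((R 0).rnDeriv P o).toReal
        - (1 / 2) * ⟪(!₂[S o] : Vec 1), η⟫_ℝ * √((R 0).rnDeriv P o).toReal) ^ 2‖ ≤
        B ^ 4 * ‖η‖ ^ 4 := by
      rw [hη, hR.self_of_nhds]
      filter_upwards [hd (τ := η 0), hd (τ := (0 : Vec 1) 0)] with o h1 h2
      have hi : ⟪(!₂[S o] : Vec 1), η⟫_ℝ = η 0 * S o := by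
        simp [PiLp.inner_apply]
      rw [h1, h2, ENNReal.toReal_ofReal (one_add_nonneg_of_bounded hB ht o), hi]
      simp only [PiLp.zero_apply, zero_mul, add_zero, ENNReal.ofReal_one, ENNReal.toReal_one,
        Real.sqrt_one, mul_one]
      have h3 := abs_sqrt_one_add_sub_le (x := η 0 * S o)
        (by linarith [one_add_nonneg_of_bounded hB ht o])
      have h4 : |η 0 * S o| ≤ ‖η‖ * B := by
        rw [abs_mul]
        exact mul_le_mul hη0 (hB o) (abs_nonneg _) (norm_nonneg _)
      rw [norm_pow, Real.norm_eq_abs]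
      calc _ ≤ ((η 0 * S o) ^ 2) ^ 2 := by gcongr
        _ = |η 0 * S o| ^ 4 := by rw [← sq_abs (η 0 * S o)]; ring
        _ ≤ (‖η‖ * B) ^ 4 := by gcongr
        _ = _ := by ring
    have := norm_integral_le_of_norm_le_const hb
    simp only [probReal_univ, mul_one] at this
    refine this.trans ?_
    rw [Real.norm_of_nonneg (by positivity)]
    calc B ^ 4 * ‖η‖ ^ 4 = (B ^ 4 * ‖η‖ ^ 2) * ‖η‖ ^ 2 := by ring
      _ ≤ c * ‖η‖ ^ 2 := by gcongr

end tilt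

end MissingLabel

/-! ### Coarsening of tilts and the induced observed-data scores -/

namespace MissingLabel

variable {d q : ℕ} {Z : Type*} [MeasurableSpace Z]

section obsScore

/-- The score of the observed data when the full data has score `h`. -/
noncomputable def obsScore (Q : Measure (FullDatum d Z)) [IsFiniteMeasure Q]
    (h : FullDatum d Z → ℝ) (o : ObsDatum d Z) : ℝ :=
  if o.1 then h o.2 else fiberMean Q h o.2.1

variable {Q : Measure (FullDatum d Z)} [IsProbabilityMeasure Q] {h : FullDatum d Z → ℝ} {B t : ℝ}

theorem obsScore_seen (u : FullDatum d Z) : obsScore Q h (seen u) = h u := by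
  simp [obsScore, seen]

theorem obsScore_unseen (u : FullDatum d Z) : obsScore Q h (unseen u) = fiberMean Q h u.1 := by
  simp [obsScore, unseen]

theorem measurable_fiberMean (hm : Measurable h) : Measurable (fiberMean Q h) :=
  (stronglyMeasurable_fiberMean hm.stronglyMeasurable).measurable

theorem measurable_obsScore (hm : Measurable h) : Measurable (obsScore Q h) :=
  Measurable.ite (measurable_fst (measurableSet_singleton true)) (hm.comp measurable_snd)
    ((measurable_fiberMean hm).comp (measurable_fst.comp measurable_snd))

theorem abs_fiberMean_le (hB : ∀ u, |h u| ≤ B) (w : Vec d × Z) : |fiberMean Q h w| ≤ B := by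
  have := norm_integral_le_of_norm_le_const (μ := Q.condKernel w) (f := fun y => h (w, y))
    (ae_of_all _ fun y => hB (w, y))
  rw [probReal_univ, mul_one] at this
  exact this

theorem abs_obsScore_le (hB : ∀ u, |h u| ≤ B) (o : ObsDatum d Z) : |obsScore Q h o| ≤ B := by
  unfold obsScore
  split
  · exact hB _
  · exact abs_fiberMean_le hB _

/-- As `F` depends on the covariates only, integrating over fibres replaces `h` by its conditional
mean; the bound on `t` keeps `1 + t h` nonnegative, so that `ENNReal.ofReal` passes through the
integral. -/
theorem lintegral_mul_tilt_density (hm : Measurable h) (hB : ∀ u, |h u| ≤ B) (ht : |t| * B ≤ 1)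
    {F : Vec d × Z → ℝ≥0∞} (hF : Measurable F) :
    ∫⁻ u, ENNReal.ofReal (1 + t * h u) * F u.1 ∂Q =
      ∫⁻ u, ENNReal.ofReal (1 + t * fiberMean Q h u.1) * F u.1 ∂Q := by
  have hfm := measurable_fiberMean (Q := Q) hm
  rw [← Measure.lintegral_condKernel (ρ := Q)
      (f := fun u => ENNReal.ofReal (1 + t * h u) * F u.1) (by fun_prop),
    ← Measure.lintegral_condKernel (ρ := Q)
      (f := fun u => ENNReal.ofReal (1 + t * fiberMean Q h u.1) * F u.1) (by fun_prop)]
  refine lintegral_congr fun w => ?_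
  dsimp only
  rw [lintegral_mul_const _ (by fun_prop), lintegral_const, measure_univ, mul_one]
  congr 1
  have hi : Integrable (fun y => h (w, y)) (Q.condKernel w) :=
    Integrable.of_bound (hm.comp measurable_prodMk_left).aestronglyMeasurable B
      (ae_of_all _ fun y => hB _)
  rw [← ofReal_integral_eq_lintegral_ofReal
    (by exact (integrable_const 1).add (hi.const_mul t))
    (ae_of_all _ fun y => one_add_nonneg_of_bounded hB ht (w, y)),
    integral_add (integrable_const 1) (hi.const_mul t), integral_const_mul]
  simp [fiberMean]

/-- Labeled data retain the density `1 + t h`, while unlabeled data see only its conditional mean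
given the covariates. The observed family is thus again exactly linear in `t`. -/
theorem obsLaw_tilt (π : ℝ) (hm : Measurable h) (hB : ∀ u, |h u| ≤ B) (ht : |t| * B ≤ 1) :
    obsLaw π (tilt Q h t) = tilt (obsLaw π Q) (obsScore Q h) t := by
  have : SFinite (tilt Q h t) := by unfold tilt; infer_instance
  have hS := measurable_obsScore (Q := Q) hm
  refine Measure.ext_of_lintegral _ fun F hF => ?_
  have hF1 : Measurable fun u : FullDatum d Z => F (seen u) := hF.comp measurable_seen
  have hF2 : Measurable fun u : FullDatum d Z => F (unseen u) := hF.comp measurable_unseen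
  rw [lintegral_obsLaw _ _ hF]
  simp only [tilt]
  rw [lintegral_withDensity_eq_lintegral_mul _ (by fun_prop) hF1,
    lintegral_withDensity_eq_lintegral_mul _ (by fun_prop) hF2,
    lintegral_withDensity_eq_lintegral_mul _ (by fun_prop) hF,
    lintegral_obsLaw _ _ (by fun_prop)]
  simp only [Pi.mul_apply, obsScore_seen, obsScore_unseen]
  congr 2
  have hF3 : Measurable fun w : Vec d × Z => F (false, w, 0) := hF.comp (by fun_prop)
  exact lintegral_mul_tilt_density hm hB ht hF3

/-- Where the label is missing, `h` is replaced by a conditional mean, which does not increase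
second moments. Approximations of full-data scores therefore pass to observed scores. -/
theorem lintegral_obsScore_sq_le {π : ℝ} (h₀ : 0 < π) (h₁ : π < 1) (hm : Measurable h) :
    ∫⁻ o, ‖obsScore Q h o‖ₑ ^ 2 ∂(obsLaw π Q) ≤ ∫⁻ u, ‖h u‖ₑ ^ 2 ∂Q := by
  rw [lintegral_obsLaw π Q ((measurable_obsScore hm).enorm.pow_const 2)]
  simp only [obsScore_seen, obsScore_unseen]
  calc _ ≤ ENNReal.ofReal π * ∫⁻ u, ‖h u‖ₑ ^ 2 ∂Q
        + ENNReal.ofReal (1 - π) * ∫⁻ u, ‖h u‖ₑ ^ 2 ∂Q := by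
        exact add_le_add le_rfl
          (mul_le_mul_right (lintegral_fiberMean_sq_le hm.stronglyMeasurable) _)
    _ = _ := by
        rw [← add_mul, ← ENNReal.ofReal_add h₀.le (by linarith)]
        simp

theorem memLp_obsScore {π : ℝ} (hm : Measurable h) (h2 : MemLp h 2 Q) :
    MemLp (obsScore Q h) 2 (obsLaw π Q) := by
  refine memLp_obsLaw (measurable_obsScore hm) ?_ ?_
  · simpa only [obsScore_seen] using h2
  · simpa only [obsScore_unseen] using memLp_fiberMean hm.stronglyMeasurable h2

theorem ae_eq_obsLaw {E : Type*} [MeasurableSpace E] [MeasurableEq E] {π : ℝ}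
    {f g : ObsDatum d Z → E} (hf : Measurable f) (hg : Measurable g)
    (h₁ : ∀ᵐ u ∂Q, f (seen u) = g (seen u)) (h₂ : ∀ᵐ u ∂Q, f (unseen u) = g (unseen u)) :
    f =ᵐ[obsLaw π Q] g := by
  have hs : MeasurableSet {o | f o = g o} := measurableSet_eq_fun hf hg
  rw [EventuallyEq, obsLaw_eq, ae_add_measure_iff]
  exact ⟨Measure.ae_smul_measure ((ae_map_iff measurable_seen.aemeasurable hs).2 h₁) _,
    Measure.ae_smul_measure ((ae_map_iff measurable_unseen.aemeasurable hs).2 h₂) _⟩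

theorem ae_integrable_condKernel {E : Type*} [NormedAddCommGroup E] {f : FullDatum d Z → E}
    (hf : Integrable f Q) : ∀ᵐ u ∂Q, Integrable (fun y => f (u.1, y)) (Q.condKernel u.1) :=
  ae_of_ae_map (f := Prod.fst) measurable_fst.aemeasurable hf.condKernel_ae

/-- Linearity holds only almost surely: sections of an integrable function may fail to be integrable
on a null set of fibres. -/
theorem obsScore_sub {π : ℝ} {g : FullDatum d Z → ℝ} (hm : Measurable h) (gm : Measurable g)
    (hh : Integrable h Q) (hg : Integrable g Q) :
    (fun o => obsScore Q h o - obsScore Q g o) =ᵐ[obsLaw π Q]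
      obsScore Q (fun u => h u - g u) := by
  refine ae_eq_obsLaw ((measurable_obsScore hm).sub (measurable_obsScore gm))
    (measurable_obsScore (hm.sub gm)) (ae_of_all _ fun u => ?_) ?_
  · simp only [obsScore_seen]
  · filter_upwards [ae_integrable_condKernel hh, ae_integrable_condKernel hg] with u h1 h2
    simp only [obsScore_unseen]
    exact (integral_sub h1 h2).symm

end obsScore

theorem exists_equiv_eq_neg_toEuclideanCLM {A : Matrix (Fin q) (Fin q) ℝ} (hA : IsUnit A.det) :
    ∃ T : Vec q ≃L[ℝ] Vec q, (T : Vec q →L[ℝ] Vec q) = -Matrix.toEuclideanCLM (𝕜 := ℝ) A := by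
  refine ⟨ContinuousLinearEquiv.equivOfInverse
    (-Matrix.toEuclideanCLM (𝕜 := ℝ) A) (-Matrix.toEuclideanCLM (𝕜 := ℝ) A⁻¹)
    (fun x => ?_) (fun x => ?_), rfl⟩
  · simp only [neg_apply, map_neg, neg_neg, toEuclideanCLM_inv_apply hA]
  · have := toEuclideanCLM_inv_apply (A := A⁻¹) (by simpa using hA) x
    rw [Matrix.nonsing_inv_nonsing_inv A hA] at this
    simp only [neg_apply, map_neg, neg_neg, this]

/-! ### Bounded tilts as regular submodels -/

section submodel

variable {ψ : ℝ → Vec d → Vec q → Vec q} {Θ : Set (Vec q)} {π : ℝ}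
  {Q₀ : Measure (FullDatum d Z)} [IsProbabilityMeasure Q₀] {θ₀ : Vec q}
  {A : Matrix (Fin q) (Fin q) ℝ} {h : FullDatum d Z → ℝ} {B : ℝ}

/-- Tilted laws stay in the model. -/
theorem eventually_inModel_tilt
    (hΘ : IsCompact Θ) (hθ₀ : θ₀ ∈ interior Θ)
    (hroot : ∀ θ ∈ Θ, ∫ u, estFun ψ θ u ∂Q₀ = 0 ↔ θ = θ₀)
    (hmeas : ∀ θ ∈ Θ, Measurable fun p : ℝ × Vec d => ψ p.1 p.2 θ)
    (hmoment : ∃ C : ℝ≥0, ∀ θ ∈ Θ, ∫⁻ u, ‖estFun ψ θ u‖ₑ ^ 2 ∂Q₀ ≤ C)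
    (hcont : ContinuousOn (fun θ => ∫ u, estFun ψ θ u ∂Q₀) Θ)
    (hlip : ∃ L : ℝ, ∀ᶠ p : Vec q × Vec q in 𝓝 (θ₀, θ₀),
      ∫ u, ‖estFun ψ p.1 u - estFun ψ p.2 u‖ ∂Q₀ ≤ L * ‖p.1 - p.2‖)
    (hA : IsUnit A.det)
    (hderiv : HasStrictFDerivAt (fun θ => ∫ u, estFun ψ θ u ∂Q₀)
      (-Matrix.toEuclideanCLM (𝕜 := ℝ) A) θ₀)
    (hm : Measurable h) (hB : ∀ u, |h u| ≤ B) (hmean : ∫ u, h u ∂Q₀ = 0) :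
    ∀ᶠ t : ℝ in 𝓝 0, InModel ψ Θ (tilt Q₀ h t) := by
  obtain ⟨C, hC⟩ := hmoment
  obtain ⟨L, hL⟩ := hlip
  have hB0 : 0 ≤ B := by
    obtain ⟨u⟩ : Nonempty (FullDatum d Z) := nonempty_of_isProbabilityMeasure Q₀
    exact (abs_nonneg _).trans (hB u)
  have hψm : ∀ θ ∈ Θ, Measurable (estFun ψ θ : FullDatum d Z → Vec q) :=
    fun θ hθ => measurable_estFun (hmeas θ hθ)
  have hψ : ∀ θ ∈ Θ, MemLp (estFun ψ θ) 2 Q₀ := fun θ hθ =>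
    memLp_two_of_lintegral_le (hψm θ hθ).aestronglyMeasurable (hC θ hθ)
  have hψi : ∀ θ ∈ Θ, Integrable (estFun ψ θ) Q₀ := fun θ hθ => (hψ θ hθ).integrable one_le_two
  have hhψ : ∀ θ ∈ Θ, Integrable (fun u => h u • estFun ψ θ u) Q₀ := fun θ hθ =>
    (hψi θ hθ).bdd_smul B hm.aestronglyMeasurable (ae_of_all _ hB)
  obtain ⟨T, hT⟩ := exists_equiv_eq_neg_toEuclideanCLM hA
  rw [← hT] at hderiv
  have hΘ2 : ∀ᶠ p : Vec q × Vec q in 𝓝 (θ₀, θ₀), p.1 ∈ Θ ∧ p.2 ∈ Θ := by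
    have hΘ1 : ∀ᶠ θ in 𝓝 θ₀, θ ∈ Θ := mem_interior_iff_mem_nhds.1 hθ₀
    rw [nhds_prod_eq]
    exact hΘ1.prod_mk hΘ1
  -- The tilted mean is `m + t p` with `p(θ) = E{h ψ(θ)}`; boundedness of `h` transfers the `L¹`
  -- Lipschitz condition to `p`.
  have hp : ∀ᶠ x : Vec q × Vec q in 𝓝 (θ₀, θ₀),
      ‖∫ u, h u • estFun ψ x.1 u ∂Q₀ - ∫ u, h u • estFun ψ x.2 u ∂Q₀‖ ≤
        (B * L) * ‖x.1 - x.2‖ := by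
    filter_upwards [hΘ2, hL] with x hx hLx
    rw [← integral_sub (hhψ _ hx.1) (hhψ _ hx.2)]
    calc _ ≤ ∫ u, B * ‖estFun ψ x.1 u - estFun ψ x.2 u‖ ∂Q₀ := by
          refine norm_integral_le_of_norm_le
            (((hψi _ hx.1).sub (hψi _ hx.2)).norm.const_mul B) (ae_of_all _ fun u => ?_)
          rw [← smul_sub, norm_smul]
          exact mul_le_mul_of_nonneg_right (hB u) (norm_nonneg _)
      _ ≤ _ := by
          rw [integral_const_mul, mul_assoc]
          exact mul_le_mul_of_nonneg_left hLx hB0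
  have hK : ∀ θ ∈ Θ, ‖∫ u, h u • estFun ψ θ u ∂Q₀‖ ≤ B * (1 + C) := by
    intro θ hθ
    have h2 := integral_sq_norm_le_of_lintegral_le (hψm θ hθ).aestronglyMeasurable (hC θ hθ)
    have hi : Integrable (fun u => ‖estFun ψ θ u‖ ^ 2) Q₀ := (hψ θ hθ).integrable_norm_pow'
    calc _ ≤ ∫ u, B * (1 + ‖estFun ψ θ u‖ ^ 2) ∂Q₀ := by
          refine norm_integral_le_of_norm_le (((integrable_const 1).add hi).const_mul B)
            (ae_of_all _ fun u => ?_)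
          rw [norm_smul]
          refine mul_le_mul (hB u) ?_ (norm_nonneg _) hB0
          nlinarith [sq_nonneg (‖estFun ψ θ u‖ - 1)]
      _ ≤ _ := by
          rw [integral_const_mul, integral_add (integrable_const 1) hi]
          simp only [integral_const, probReal_univ, one_smul]
          gcongr
  have hsmall : ∀ᶠ t : ℝ in 𝓝 0, |t| * B ≤ 1 := by
    have : Continuous fun t : ℝ => |t| * B := by fun_prop
    exact ((tendsto_order.1 (this.tendsto 0)).2 1 (by simp)).mono fun _ h => h.le
  have hex := eventually_existsUnique_root (m := fun θ => ∫ u, estFun ψ θ u ∂Q₀)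
    (p := fun θ => ∫ u, h u • estFun ψ θ u ∂Q₀) (T := T) hΘ hθ₀ hcont hroot hderiv hp hK
  filter_upwards [hex, hsmall] with t h1 ht
  refine ⟨isProbabilityMeasure_tilt hm hB hmean ht, fun θ hθ =>
    (hψ θ hθ).of_measure_le_smul (by simp) (tilt_le hB ht), ?_⟩
  refine (existsUnique_congr fun θ => and_congr_right fun hθ => ?_).1 h1
  rw [integral_tilt hm hB ht (hψi θ hθ)]

/-- Tilting by a bounded function with mean zero gives a regular parametric submodel. -/
theorem isRegularSubmodel_tilt (h₀ : 0 < π) (h₁ : π < 1)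
    (hΘ : IsCompact Θ) (hθ₀ : θ₀ ∈ interior Θ)
    (hroot : ∀ θ ∈ Θ, ∫ u, estFun ψ θ u ∂Q₀ = 0 ↔ θ = θ₀)
    (hmeas : ∀ θ ∈ Θ, Measurable fun p : ℝ × Vec d => ψ p.1 p.2 θ)
    (hmoment : ∃ C : ℝ≥0, ∀ θ ∈ Θ, ∫⁻ u, ‖estFun ψ θ u‖ₑ ^ 2 ∂Q₀ ≤ C)
    (hcont : ContinuousOn (fun θ => ∫ u, estFun ψ θ u ∂Q₀) Θ)
    (hcont₂ : Tendsto (fun θ => ∫⁻ u, ‖estFun ψ θ u - estFun ψ θ₀ u‖ₑ ^ 2 ∂Q₀)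
      (𝓝 θ₀) (𝓝 0))
    (hlip : ∃ L : ℝ, ∀ᶠ p : Vec q × Vec q in 𝓝 (θ₀, θ₀),
      ∫ u, ‖estFun ψ p.1 u - estFun ψ p.2 u‖ ∂Q₀ ≤ L * ‖p.1 - p.2‖)
    (hA : IsUnit A.det)
    (hderiv : HasStrictFDerivAt (fun θ => ∫ u, estFun ψ θ u ∂Q₀)
      (-Matrix.toEuclideanCLM (𝕜 := ℝ) A) θ₀)
    (hm : Measurable h) (hB : ∀ u, |h u| ≤ B) (hmean : ∫ u, h u ∂Q₀ = 0) :
    IsRegularSubmodel ψ Θ π Q₀ θ₀ (fun η : Vec 1 => tilt Q₀ h (η 0))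
      (fun o => !₂[obsScore Q₀ h o]) := by
  have hproj : Tendsto (fun η : Vec 1 => η 0) (𝓝 0) (𝓝 0) := by
    have : Continuous fun η : Vec 1 => η 0 := by fun_prop
    simpa using this.tendsto 0
  have hsmall : ∀ᶠ η : Vec 1 in 𝓝 0, |η 0| * B ≤ 1 := by
    have : Continuous fun η : Vec 1 => |η 0| * B := by fun_prop
    exact ((tendsto_order.1 (this.tendsto 0)).2 1 (by simp)).mono fun _ h => h.le
  have hP := isProbabilityMeasure_obsLaw h₀ h₁ Q₀
  -- The density `1 + t h` is at most `2`, so moment conditions pass from `Q₀` to its tilts.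
  have hle : ∀ {t : ℝ}, |t| * B ≤ 1 → ∀ f : FullDatum d Z → ℝ≥0∞,
      ∫⁻ u, f u ∂(tilt Q₀ h t) ≤ 2 * ∫⁻ u, f u ∂Q₀ := fun ht f => by
    refine (lintegral_mono' (tilt_le hB ht) le_rfl).trans_eq ?_
    rw [lintegral_smul_measure]
    rfl
  refine ⟨by simp [tilt_zero], ?_, ?_, ?_, ?_⟩
  · exact hproj.eventually (eventually_inModel_tilt hΘ hθ₀ hroot hmeas hmoment hcont hlip hA
      hderiv hm hB hmean)
  · exact hasScore_of_eventually_eq_tilt (measurable_obsScore hm) (abs_obsScore_le hB)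
      (hsmall.mono fun η hη => obsLaw_tilt π hm hB hη)
  · obtain ⟨C, hC⟩ := hmoment
    refine ⟨2 * C, hsmall.mono fun η hη θ hθ => (hle hη _).trans ?_⟩
    rw [ENNReal.coe_mul]
    exact mul_le_mul_right (hC θ hθ) _
  · have h1 : Tendsto (fun p : Vec 1 × Vec q =>
        2 * ∫⁻ u, ‖estFun ψ p.2 u - estFun ψ θ₀ u‖ₑ ^ 2 ∂Q₀) (𝓝 (0, θ₀)) (𝓝 0) := by
      have := ENNReal.Tendsto.const_mul (a := 2)
        (hcont₂.comp (continuous_snd.tendsto ((0 : Vec 1), θ₀))) (Or.inr (by simp))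
      simpa using this
    refine tendsto_of_tendsto_of_tendsto_of_le_of_le' tendsto_const_nhds h1
      (Eventually.of_forall fun _ => zero_le) ?_
    filter_upwards [(continuous_fst.tendsto ((0 : Vec 1), θ₀)).eventually hsmall] with p hp
    exact hle hp _

end submodel

end MissingLabel

/-! ### Membership of the formula in the tangent space -/

namespace MissingLabel

variable {d q : ℕ} {Z : Type*} [MeasurableSpace Z]

section closure

variable {π : ℝ} {Q : Measure (FullDatum d Z)} {h : FullDatum d Z → ℝ}

/-- The truncation of `h`, recentred to have mean zero. -/
noncomputable def centeredTruncate (Q : Measure (FullDatum d Z)) (h : FullDatum d Z → ℝ) (n : ℕ)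
    (u : FullDatum d Z) : ℝ :=
  truncate h n u - ∫ u', truncate h n u' ∂Q

theorem measurable_centeredTruncate (hm : Measurable h) (n : ℕ) :
    Measurable (centeredTruncate Q h n) :=
  (measurable_truncate hm n).sub measurable_const

variable [IsProbabilityMeasure Q]

theorem integrable_truncate (hm : Measurable h) (n : ℕ) : Integrable (truncate h n) Q :=
  Integrable.of_bound (measurable_truncate hm n).aestronglyMeasurable n
    (ae_of_all _ (abs_truncate_le h n))

theorem abs_centeredTruncate_le (n : ℕ) (u : FullDatum d Z) :
    |centeredTruncate Q h n u| ≤ n + n := by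
  refine (abs_sub _ _).trans (add_le_add (abs_truncate_le h n u) ?_)
  have := norm_integral_le_of_norm_le_const (μ := Q) (f := truncate h n)
    (ae_of_all _ (abs_truncate_le h n))
  rwa [probReal_univ, mul_one] at this

theorem integral_centeredTruncate (hm : Measurable h) (n : ℕ) :
    ∫ u, centeredTruncate Q h n u ∂Q = 0 := by
  simp only [centeredTruncate]
  rw [integral_sub (integrable_truncate hm n) (integrable_const _)]
  simp

/-- Dominated convergence with bound `(2|h| + E|h|)²`; the centring constants tend to the mean of
`h`, which is zero. -/
theorem tendsto_lintegral_centeredTruncate_sub_sq (hm : Measurable h) (h2 : MemLp h 2 Q)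
    (hmean : ∫ u, h u ∂Q = 0) :
    Tendsto (fun n => ∫⁻ u, ‖centeredTruncate Q h n u - h u‖ₑ ^ 2 ∂Q) atTop (𝓝 0) := by
  have hi := h2.integrable one_le_two
  have hc : Tendsto (fun n => ∫ u, truncate h n u ∂Q) atTop (𝓝 0) := by
    rw [← hmean]
    refine tendsto_integral_of_dominated_convergence (fun u => |h u|)
      (fun n => (measurable_truncate hm n).aestronglyMeasurable) hi.abs
      (fun n => ae_of_all _ (abs_truncate_le_abs h n)) (ae_of_all _ fun u => ?_)
    exact tendsto_const_nhds.congr' ((eventually_truncate_eq h u).mono fun n hn => hn.symm)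
  have hcb : ∀ n, |∫ u, truncate h n u ∂Q| ≤ ∫ u, |h u| ∂Q := fun n => by
    rw [← Real.norm_eq_abs]
    exact norm_integral_le_of_norm_le hi.abs (ae_of_all _ (abs_truncate_le_abs h n))
  have hg : MemLp (fun u => |h u| + |h u| + ∫ u, |h u| ∂Q) 2 Q :=
    (h2.abs.add h2.abs).add (memLp_const _)
  have hz : ∫⁻ _ : FullDatum d Z, (0 : ℝ≥0∞) ∂Q = 0 := by simp
  rw [← hz]
  refine tendsto_lintegral_of_dominated_convergence
    (fun u => ‖|h u| + |h u| + ∫ u, |h u| ∂Q‖ₑ ^ 2)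
    (fun n => ((measurable_centeredTruncate hm n).sub hm).enorm.pow_const 2) (fun n => ?_)
    (lintegral_sq_lt_top_of_memLp hg).ne (ae_of_all _ fun u => ?_)
  · filter_upwards with u
    gcongr
    rw [enorm_le_iff_norm_le, Real.norm_eq_abs, Real.norm_eq_abs]
    refine le_trans ?_ (le_abs_self _)
    have e : centeredTruncate Q h n u - h u =
        (truncate h n u - h u) - ∫ u', truncate h n u' ∂Q := by
      simp only [centeredTruncate]; ring
    rw [e]
    refine (abs_sub _ _).trans (add_le_add ((abs_sub _ _).trans ?_) (hcb n))
    exact add_le_add (abs_truncate_le_abs h n u) le_rfl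
  · have h1 : Tendsto (fun n => centeredTruncate Q h n u - h u) atTop (𝓝 0) := by
      have ht : Tendsto (fun n => truncate h n u) atTop (𝓝 (h u)) :=
        tendsto_const_nhds.congr' ((eventually_truncate_eq h u).mono fun n hn => hn.symm)
      simpa [centeredTruncate] using (ht.sub hc).sub_const (h u)
    have h3 : Continuous fun x : ℝ => ‖x‖ₑ ^ 2 := by fun_prop
    have h4 := (h3.tendsto 0).comp h1
    rw [enorm_zero, zero_pow two_ne_zero] at h4
    exact h4

theorem tendsto_eLpNorm_two_of_tendsto_lintegral {Ω : Type*} [MeasurableSpace Ω] {P : Measure Ω}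
    {f : ℕ → Ω → ℝ} (hf : Tendsto (fun n => ∫⁻ o, ‖f n o‖ₑ ^ 2 ∂P) atTop (𝓝 0)) :
    Tendsto (fun n => eLpNorm (f n) 2 P) atTop (𝓝 0) := by
  have e : ∀ n, eLpNorm (f n) 2 P = (∫⁻ o, ‖f n o‖ₑ ^ 2 ∂P) ^ (1 / 2 : ℝ) := fun n => by
    rw [eLpNorm_eq_lintegral_rpow_enorm_toReal (by norm_num) (by norm_num)]
    simp
  simp only [e]
  have := (ENNReal.continuous_rpow_const (y := 1 / 2)).tendsto 0 |>.comp hf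
  simpa [Function.comp_def] using this

/-- If the observed-data scores of bounded functions of mean zero belong to a closed subspace, then
so do those of square integrable functions of mean zero. -/
theorem toLp_obsScore_mem (h₀ : 0 < π) (h₁ : π < 1) {T : Submodule ℝ (Lp ℝ 2 (obsLaw π Q))}
    (hT : IsClosed (T : Set (Lp ℝ 2 (obsLaw π Q))))
    (hbdd : ∀ (g : FullDatum d Z → ℝ) (B : ℝ), Measurable g → (∀ u, |g u| ≤ B) →
      ∫ u, g u ∂Q = 0 → ∀ hg : MemLp (obsScore Q g) 2 (obsLaw π Q), hg.toLp _ ∈ T)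
    (hm : Measurable h) (h2 : MemLp h 2 Q) (hmean : ∫ u, h u ∂Q = 0) :
    (memLp_obsScore (π := π) hm h2).toLp _ ∈ T := by
  have := isProbabilityMeasure_obsLaw h₀ h₁ Q
  have htm := measurable_centeredTruncate (Q := Q) hm
  have htb := abs_centeredTruncate_le (Q := Q) (h := h)
  have ht2 : ∀ n, MemLp (centeredTruncate Q h n) 2 Q := fun n =>
    MemLp.of_bound (htm n).aestronglyMeasurable _ (ae_of_all _ (htb n))
  refine hT.mem_of_tendsto (b := atTop) ((Lp.tendsto_Lp_iff_tendsto_eLpNorm''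
    (fun n => obsScore Q (centeredTruncate Q h n)) (fun n => memLp_obsScore (htm n) (ht2 n))
    (obsScore Q h) (memLp_obsScore hm h2)).2 ?_)
    (Eventually.of_forall fun n => hbdd _ _ (htm n) (htb n) (integral_centeredTruncate hm n) _)
  refine tendsto_eLpNorm_two_of_tendsto_lintegral ?_
  refine tendsto_of_tendsto_of_tendsto_of_le_of_le tendsto_const_nhds
    (tendsto_lintegral_centeredTruncate_sub_sq hm h2 hmean) (fun _ => zero_le) (fun n => ?_)
  refine le_trans (le_of_eq ?_) (lintegral_obsScore_sq_le h₀ h₁ ((htm n).sub hm))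
  refine lintegral_congr_ae ?_
  filter_upwards [obsScore_sub (π := π) (htm n) hm ((ht2 n).integrable one_le_two)
    (h2.integrable one_le_two)] with o ho
  exact congrArg (fun x : ℝ => ‖x‖ₑ ^ 2) ho

end closure

section formula

variable {ψ : ℝ → Vec d → Vec q → Vec q} {π : ℝ} {Q : Measure (FullDatum d Z)}
  [IsProbabilityMeasure Q] {θ : Vec q}

theorem memLp_eifFormula (A : Matrix (Fin q) (Fin q) ℝ)
    (hm : Measurable (estFun ψ θ : FullDatum d Z → Vec q)) (h2 : MemLp (estFun ψ θ) 2 Q) :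
    MemLp (eifFormula ψ π A θ Q) 2 (obsLaw π Q) := by
  have e : eifFormula ψ π A θ Q = fun o => Matrix.toEuclideanCLM (𝕜 := ℝ) A⁻¹
      (ipw π (estFun ψ θ) o + augment π (fiberMean Q (estFun ψ θ)) o) :=
    funext fun o => eifFormula_eq ψ π A θ Q o
  rw [e]
  exact (Matrix.toEuclideanCLM (𝕜 := ℝ) A⁻¹).comp_memLp' ((memLp_ipw hm h2).add
    (memLp_augment (stronglyMeasurable_fiberMean hm.stronglyMeasurable).measurable
      (memLp_fiberMean hm.stronglyMeasurable h2)))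

/-- The full data score that induces the score of the observed data
`ipw f + augment (E[f | x, z])`. -/
noncomputable def inducingScore (π : ℝ) (Q : Measure (FullDatum d Z)) [IsFiniteMeasure Q]
    (f : FullDatum d Z → ℝ) (u : FullDatum d Z) : ℝ :=
  π⁻¹ * f u + (1 - π⁻¹) * fiberMean Q f u.1

variable {f : FullDatum d Z → ℝ}

theorem measurable_inducingScore (hm : Measurable f) : Measurable (inducingScore π Q f) :=
  (hm.const_mul _).add (((measurable_fiberMean hm).comp measurable_fst).const_mul _)

theorem memLp_inducingScore (hm : Measurable f) (h2 : MemLp f 2 Q) :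
    MemLp (inducingScore π Q f) 2 Q :=
  (h2.const_mul _).add ((memLp_fiberMean hm.stronglyMeasurable h2).const_mul _)

theorem integral_inducingScore (hm : Measurable f) (h2 : MemLp f 2 Q) :
    ∫ u, inducingScore π Q f u ∂Q = ∫ u, f u ∂Q := by
  have hi := h2.integrable one_le_two
  have hi2 := (memLp_fiberMean hm.stronglyMeasurable h2).integrable one_le_two
  simp only [inducingScore]
  rw [integral_add (hi.const_mul _) (hi2.const_mul _), integral_const_mul, integral_const_mul,
    integral_fiberMean hi hm.stronglyMeasurable]
  ring

/-- A conditional mean is constant on fibres, and the weights satisfy `π⁻¹ + (1 - π⁻¹) = 1`. Hence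
the induced score on unlabeled data is the conditional mean of `f`, as the formula requires. -/
theorem fiberMean_inducingScore (hi : Integrable f Q) :
    ∀ᵐ u ∂Q, fiberMean Q (inducingScore π Q f) u.1 = fiberMean Q f u.1 := by
  filter_upwards [ae_integrable_condKernel hi] with u hu
  rw [fiberMean]
  simp only [inducingScore]
  rw [integral_add (hu.const_mul _) (integrable_const _), integral_const_mul, integral_const,
    probReal_univ, one_smul]
  change π⁻¹ * fiberMean Q f u.1 + _ = _
  ring

/-- The coordinates of the efficient influence function are scores of the observed data. -/
theorem eifFormula_apply_ae_eq (A : Matrix (Fin q) (Fin q) ℝ)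
    (hm : Measurable (estFun ψ θ : FullDatum d Z → Vec q)) (hi : Integrable (estFun ψ θ) Q)
    (j : Fin q) :
    obsScore Q (inducingScore π Q fun u => Matrix.toEuclideanCLM (𝕜 := ℝ) A⁻¹ (estFun ψ θ u) j)
      =ᵐ[obsLaw π Q] fun o => eifFormula ψ π A θ Q o j := by
  set ℓ : Vec q →L[ℝ] ℝ :=
    (EuclideanSpace.proj (𝕜 := ℝ) j).comp (Matrix.toEuclideanCLM (𝕜 := ℝ) A⁻¹) with hℓ
  have hℓa : ∀ x, Matrix.toEuclideanCLM (𝕜 := ℝ) A⁻¹ x j = ℓ x := fun x => rfl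
  have hfm : Measurable fun u : FullDatum d Z => ℓ (estFun ψ θ u) := ℓ.measurable.comp hm
  have hfi : Integrable (fun u => ℓ (estFun ψ θ u)) Q := ℓ.integrable_comp hi
  have hlin : ∀ᵐ u ∂Q, fiberMean Q (fun u => ℓ (estFun ψ θ u)) u.1 =
      ℓ (fiberMean Q (estFun ψ θ) u.1) := by
    filter_upwards [ae_integrable_condKernel hi] with u hu
    exact ℓ.integral_comp_comm hu
  simp only [hℓa, eifFormula_eq]
  have hmeas : Measurable fun o : ObsDatum d Z =>
      ℓ (ipw π (estFun ψ θ) o + augment π (fiberMean Q (estFun ψ θ)) o) :=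
    ℓ.measurable.comp ((measurable_ipw hm).add
      (measurable_augment (stronglyMeasurable_fiberMean hm.stronglyMeasurable).measurable))
  refine ae_eq_obsLaw (measurable_obsScore (measurable_inducingScore hfm)) hmeas ?_ ?_
  · filter_upwards [hlin] with u hu
    rw [obsScore_seen, ipw_seen, augment_seen, inducingScore, hu, map_add, map_smul, map_smul,
      smul_eq_mul, smul_eq_mul]
  · filter_upwards [hlin, fiberMean_inducingScore (π := π) hfi] with u hu hu2
    rw [obsScore_unseen, ipw_unseen, augment_unseen, hu2, hu, zero_add]

end formula

/-! ### Uniqueness by orthogonality -/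

section uniqueness

variable {ψ : ℝ → Vec d → Vec q → Vec q} {Θ : Set (Vec q)} {π : ℝ}
  {Q₀ : Measure (FullDatum d Z)} {θ₀ : Vec q}

/-- Efficient influence functions are unique up to almost sure equality. -/
theorem IsEIF.ae_eq {φ φ' : ObsDatum d Z → Vec q} (hφ : IsEIF ψ Θ π Q₀ θ₀ φ)
    (hφ' : IsEIF ψ Θ π Q₀ θ₀ φ') : φ =ᵐ[obsLaw π Q₀] φ' := by
  have hj : ∀ j : Fin q, ∀ᵐ o ∂(obsLaw π Q₀), φ o j = φ' o j := by
    intro j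
    obtain ⟨g, hg, hgφ⟩ := hφ.mem_tangent j
    obtain ⟨g', hg', hgφ'⟩ := hφ'.mem_tangent j
    have hmem : g - g' ∈ tangentSpace ψ Θ π Q₀ θ₀ := Submodule.sub_mem _ hg hg'
    -- Orthogonality to the closure of a span need only be checked on scores, where it says that
    -- both functions represent the same derivative.
    have horth : g - g' ∈ (tangentSpace ψ Θ π Q₀ θ₀)ᗮ := by
      rw [tangentSpace, Submodule.orthogonal_closure, Submodule.mem_orthogonal]
      intro x hx
      induction hx using Submodule.span_induction with
      | zero => simp
      | add x y _ _ hx hy => rw [inner_add_left, hx, hy, add_zero]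
      | smul c x _ hx => rw [inner_smul_left, hx, mul_zero]
      | mem x hx =>
        obtain ⟨k, Q, s, v, hsub, hxs⟩ := hx
        obtain ⟨D, hD, hd⟩ := hφ.gradient k Q s hsub
        obtain ⟨D', hD', hd'⟩ := hφ'.gradient k Q s hsub
        have hDD : D v = D' v := by rw [hd.unique hd']
        rw [hD, hD'] at hDD
        have hs : MemLp s 2 (obsLaw π Q₀) := by
          rw [← hsub.at_zero]
          exact hsub.score.1
        have hi := integrable_inner_smul hs hφ.memLp v
        have hi' := integrable_inner_smul hs hφ'.memLp v
        have c1 : ∫ o, (⟪s o, v⟫_ℝ • φ o) j ∂(obsLaw π Q₀) =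
            (∫ o, ⟪s o, v⟫_ℝ • φ o ∂(obsLaw π Q₀)) j :=
          (EuclideanSpace.proj (𝕜 := ℝ) j).integral_comp_comm hi
        have c2 : ∫ o, (⟪s o, v⟫_ℝ • φ' o) j ∂(obsLaw π Q₀) =
            (∫ o, ⟪s o, v⟫_ℝ • φ' o ∂(obsLaw π Q₀)) j :=
          (EuclideanSpace.proj (𝕜 := ℝ) j).integral_comp_comm hi'
        have i1 : Integrable (fun o => (⟪s o, v⟫_ℝ • φ o) j) (obsLaw π Q₀) :=
          (EuclideanSpace.proj (𝕜 := ℝ) j).integrable_comp hi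
        have i2 : Integrable (fun o => (⟪s o, v⟫_ℝ • φ' o) j) (obsLaw π Q₀) :=
          (EuclideanSpace.proj (𝕜 := ℝ) j).integrable_comp hi'
        rw [L2.inner_def]
        calc _ = ∫ o, ((⟪s o, v⟫_ℝ • φ o) j - (⟪s o, v⟫_ℝ • φ' o) j) ∂(obsLaw π Q₀) := by
              refine integral_congr_ae ?_
              filter_upwards [hxs, hgφ, hgφ', Lp.coeFn_sub g g'] with o h1 h2 h3 h4
              rw [h1, h4, Pi.sub_apply, h2, h3]
              simp
              ring
          _ = 0 := by rw [integral_sub i1 i2, c1, c2, hDD, sub_self]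
    have h0 : g - g' = 0 := by
      have := (Submodule.mem_orthogonal _ _).1 horth _ hmem
      exact inner_self_eq_zero.1 this
    rw [sub_eq_zero] at h0
    filter_upwards [hgφ, hgφ'] with o h1 h2
    rw [← h1, ← h2, h0]
  filter_upwards [ae_all_iff.2 hj] with o ho
  ext j
  exact ho j

end uniqueness

end MissingLabel

/-! ### The efficient influence function -/

theorem proposition2 {d q : ℕ} {Z : Type*} [MeasurableSpace Z]
    (ψ : ℝ → Vec d → Vec q → Vec q) (Θ : Set (Vec q)) (π : ℝ)
    (Q₀ : Measure (FullDatum d Z)) [IsProbabilityMeasure Q₀] (θ₀ : Vec q)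
    (A : Matrix (Fin q) (Fin q) ℝ)
    (hπ₀ : 0 < π) (hπ₁ : π < 1)
    -- the parameter space, and the true parameter as the unique root
    (hΘ : IsCompact Θ) (hθ₀ : θ₀ ∈ interior Θ)
    (hroot : ∀ θ ∈ Θ, ∫ u, estFun ψ θ u ∂Q₀ = 0 ↔ θ = θ₀)
    -- measurability and moments of the estimating function
    (hmeas : ∀ θ ∈ Θ, Measurable fun p : ℝ × Vec d => ψ p.1 p.2 θ)
    (hmoment : ∃ C : ℝ≥0, ∀ θ ∈ Θ, ∫⁻ u, ‖estFun ψ θ u‖ₑ ^ 2 ∂Q₀ ≤ C)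
    -- regularity in `θ`
    (hcont : ContinuousOn (fun θ => ∫ u, estFun ψ θ u ∂Q₀) Θ)
    (hcont₂ : Tendsto (fun θ => ∫⁻ u, ‖estFun ψ θ u - estFun ψ θ₀ u‖ₑ ^ 2 ∂Q₀)
      (𝓝 θ₀) (𝓝 0))
    (hlip : ∃ L : ℝ, ∀ᶠ p : Vec q × Vec q in 𝓝 (θ₀, θ₀),
      ∫ u, ‖estFun ψ p.1 u - estFun ψ p.2 u‖ ∂Q₀ ≤ L * ‖p.1 - p.2‖)
    -- `A = -∂ E ψ(Y, X; θ) / ∂θᵀ` at `θ₀`, nonsingular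
    (hA : IsUnit A.det)
    (hderiv : HasStrictFDerivAt (fun θ => ∫ u, estFun ψ θ u ∂Q₀)
      (-Matrix.toEuclideanCLM (𝕜 := ℝ) A) θ₀) :
    IsEIF ψ Θ π Q₀ θ₀ (eifFormula ψ π A θ₀ Q₀) ∧
      ∀ φ : ObsDatum d Z → Vec q, IsEIF ψ Θ π Q₀ θ₀ φ →
        φ =ᵐ[obsLaw π Q₀] eifFormula ψ π A θ₀ Q₀ := by
  have hθ₀Θ := interior_subset hθ₀
  have hm : Measurable (estFun ψ θ₀ : FullDatum d Z → Vec q) := measurable_estFun (hmeas θ₀ hθ₀Θ)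
  have h2 : MemLp (estFun ψ θ₀) 2 Q₀ := by
    obtain ⟨C, hC⟩ := hmoment
    exact memLp_two_of_lintegral_le hm.aestronglyMeasurable (hC θ₀ hθ₀Θ)
  have hi := h2.integrable one_le_two
  have hP := isProbabilityMeasure_obsLaw hπ₀ hπ₁ Q₀
  have heif : IsEIF ψ Θ π Q₀ θ₀ (eifFormula ψ π A θ₀ Q₀) := by
    refine ⟨memLp_eifFormula A hm h2, fun j => ?_, fun k Q s hsub => ?_⟩
    · set ℓ : Vec q →L[ℝ] ℝ :=
        (EuclideanSpace.proj (𝕜 := ℝ) j).comp (Matrix.toEuclideanCLM (𝕜 := ℝ) A⁻¹)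
      have hfm : Measurable fun u : FullDatum d Z => ℓ (estFun ψ θ₀ u) := ℓ.measurable.comp hm
      have hf2 : MemLp (fun u : FullDatum d Z => ℓ (estFun ψ θ₀ u)) 2 Q₀ := ℓ.comp_memLp' h2
      have hmean : ∫ u, inducingScore π Q₀ (fun u => ℓ (estFun ψ θ₀ u)) u ∂Q₀ = 0 := by
        rw [integral_inducingScore hfm hf2, ℓ.integral_comp_comm hi, (hroot θ₀ hθ₀Θ).2 rfl,
          map_zero]
      refine ⟨_, toLp_obsScore_mem hπ₀ hπ₁ (Submodule.isClosed_topologicalClosure _) ?_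
        (measurable_inducingScore hfm) (memLp_inducingScore hfm hf2) hmean,
        (MemLp.coeFn_toLp _).trans (eifFormula_apply_ae_eq A hm hi j)⟩
      -- For bounded `g` of mean zero, the observed score is itself the score of the tilt by `g`, in
      -- direction `1`.
      intro g B hg hB hg0 hgL
      refine Submodule.le_topologicalClosure _ (Submodule.subset_span ?_)
      refine ⟨1, _, _, !₂[1], isRegularSubmodel_tilt hπ₀ hπ₁ hΘ hθ₀ hroot hmeas hmoment hcont
        hcont₂ hlip hA hderiv hg hB hg0, hgL.coeFn_toLp.trans (ae_of_all _ fun o => ?_)⟩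
      simp [PiLp.inner_apply]
    · obtain rfl := hsub.at_zero
      obtain ⟨C, hC⟩ := hsub.moment
      have hL := memLp_ipw (π := π) hm h2
      refine ⟨_, fun v => ?_, hasFDerivAt_param hπ₀ hπ₁ hΘ hθ₀Θ hroot hmeas hcont hcont₂ hA
        hderiv.hasFDerivAt hsub.score hsub.mem hC hL⟩
      have hQ : ∀ᶠ η in 𝓝 0, IsProbabilityMeasure (Q η) := hsub.mem.mono fun η h => h.1
      have hgm : Measurable (fiberMean (Q 0) (estFun ψ θ₀)) :=
        (stronglyMeasurable_fiberMean hm.stronglyMeasurable).measurable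
      have hg2 := memLp_fiberMean hm.stronglyMeasurable h2
      -- The derivative is the score mean of the inverse weighted part alone; the augmentation part
      -- contributes zero and so may be added to reach the formula.
      have haug := hsub.score.integral_smul_augment hπ₀ hπ₁ hQ hgm hg2 v
      have i1 := integrable_inner_smul hsub.score.1 hL v
      have i2 := integrable_inner_smul hsub.score.1 (memLp_augment (π := π) hgm hg2) v
      rw [ContinuousLinearMap.comp_apply, scoreMean_apply]
      calc _ = Matrix.toEuclideanCLM (𝕜 := ℝ) A⁻¹
            (∫ o, (⟪s o, v⟫_ℝ • ipw π (estFun ψ θ₀) o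
              + ⟪s o, v⟫_ℝ • augment π (fiberMean (Q 0) (estFun ψ θ₀)) o) ∂(obsLaw π (Q 0))) := by
            rw [integral_add i1 i2, haug, add_zero]
        _ = _ := by
            rw [← ContinuousLinearMap.integral_comp_comm _ (by exact i1.add i2)]
            congr 1 with o : 1
            rw [eifFormula_eq, ← smul_add, map_smul]
  exact ⟨heif, fun φ hφ => hφ.ae_eq heif⟩
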